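/- Let $n\ge 3$ and $p\ge 0$ be integers, let $(M^n,g)$ be a smooth Riemannian manifold, and let $f\colon M^{n}\to\mathbb{R}^{n+p}$ be a smooth isometric immersion, with induced metric $\langle\,,\,\rangle_f=g$, second fundamental form $\alpha$, mean curvature vector field $\mathcal{H}=\frac1n\operatorname{tr}\alpha$ and normal connection $\nabla^\perp$. Assume that $f$ has no umbilical points, i.e., at no point $x\in M$ is there a normal vector $\eta$ with $\alpha(X,Y)=\langle X,Y\rangle_f\,\eta$ for all $X,Y\in T_xM$. Then $$\rho=\Big(\tfrac{n}{n-1}\big(\|\alpha\|^2-n\|\mathcal{H}\|^2\big)\Big)^{1/2}$$ is a positive function, and one defines the Moebius metric $\langle\,,\,\rangle^*=\rho^2\langle\,,\,\rangle_f$, the Moebius second fundamental form $\beta(X,Y)=\rho\,(\alpha(X,Y)-\langle X,Y\rangle_f\,\mathcal{H})$, and the Moebius form of $f$, which is the one-form with values in the normal bundle given by $$\omega(X)=-\frac1\rho\big(\nabla^\perp_X\mathcal{H}+\beta(X,\operatorname{grad}^*\rho)\big),$$ where $\operatorname{grad}^*$ is the gradient with respect to $\langle\,,\,\rangle^*$.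 Suppose that $f$ has constant Moebius curvature, i.e., there is $c\in\mathbb{R}$ such that all sectional curvatures of $(M^n,\langle\,,\,\rangle^*)$ are equal to $c$, and that $f$ has flat normal bundle, i.e., the curvature tensor of $\nabla^\perp$ vanishes identically. Then the Moebius form of $f$ is closed: for all smooth vector fields $X,Y$, $$d\omega(X,Y)=\nabla^\perp_X\big(\omega(Y)\big)-\nabla^\perp_Y\big(\omega(X)\big)-\omega([X,Y])=0 .$$ -/

import Mathlib

open scoped Manifold ContDiff InnerProductSpace

noncomputable section

/-! ### Riemannian geometry in coordinates

A metric on (an open subset of) `ℝⁿ` is given by its values `G y u v = ⟨u, v⟩_y`. -/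

namespace CoordMetric

variable {n : ℕ}

/-- The standard basis vector `e i` of `ℝⁿ`, that is, the `i`-th coordinate vector. -/
def basisVec (i : Fin n) : EuclideanSpace ℝ (Fin n) := EuclideanSpace.single i 1

/-- The inverse `(g^{ij})` of the matrix `(g_{ij})` of the metric in the coordinate frame. -/
def invGram (G : EuclideanSpace ℝ (Fin n) → EuclideanSpace ℝ (Fin n) → EuclideanSpace ℝ (Fin n) → ℝ)
    (y : EuclideanSpace ℝ (Fin n)) : Matrix (Fin n) (Fin n) ℝ :=
  (Matrix.of fun i j => G y (basisVec i) (basisVec j))⁻¹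

/-- The vector dual to a linear functional `l` with respect to the metric at `y`:
the vector `s` with `⟨s, w⟩_y = l w` for all `w`, in coordinates `s^i = ∑ j, g^{ij} l_j`. -/
def sharp (G : EuclideanSpace ℝ (Fin n) → EuclideanSpace ℝ (Fin n) → EuclideanSpace ℝ (Fin n) → ℝ)
    (y : EuclideanSpace ℝ (Fin n)) (l : EuclideanSpace ℝ (Fin n) → ℝ) :
    EuclideanSpace ℝ (Fin n) :=
  ∑ i, (∑ j, invGram G y i j * l (basisVec j)) • basisVec i

/-- The gradient of a function with respect to the metric. -/
def grad (G : EuclideanSpace ℝ (Fin n) → EuclideanSpace ℝ (Fin n) → EuclideanSpace ℝ (Fin n) → ℝ)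
    (r : EuclideanSpace ℝ (Fin n) → ℝ) (y : EuclideanSpace ℝ (Fin n)) :
    EuclideanSpace ℝ (Fin n) :=
  sharp G y (fun w => fderiv ℝ r y w)

/-- The Christoffel symbols of the Levi-Civita connection: `christoffel G y u v` is the value at
`y` of `∇_u v` for the constant coordinate fields `u`, `v` (Koszul formula). -/
def christoffel
    (G : EuclideanSpace ℝ (Fin n) → EuclideanSpace ℝ (Fin n) → EuclideanSpace ℝ (Fin n) → ℝ)
    (y u v : EuclideanSpace ℝ (Fin n)) : EuclideanSpace ℝ (Fin n) :=
  sharp G y (fun w => (1 / 2 : ℝ) *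
    (fderiv ℝ (fun z => G z v w) y u + fderiv ℝ (fun z => G z u w) y v
      - fderiv ℝ (fun z => G z u v) y w))

/-- The Levi-Civita covariant derivative at `y` of a vector field `Y` in the direction `u`. -/
def covDeriv
    (G : EuclideanSpace ℝ (Fin n) → EuclideanSpace ℝ (Fin n) → EuclideanSpace ℝ (Fin n) → ℝ)
    (y u : EuclideanSpace ℝ (Fin n)) (Y : EuclideanSpace ℝ (Fin n) → EuclideanSpace ℝ (Fin n)) :
    EuclideanSpace ℝ (Fin n) :=
  fderiv ℝ Y y u + christoffel G y u (Y y)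

/-- The curvature tensor `R(u, v) w = ∇_u ∇_v w - ∇_v ∇_u w - ∇_{[u, v]} w` at `y`, evaluated on
constant coordinate fields `u`, `v`, `w`, for which `[u, v] = 0`. -/
def curvature
    (G : EuclideanSpace ℝ (Fin n) → EuclideanSpace ℝ (Fin n) → EuclideanSpace ℝ (Fin n) → ℝ)
    (y u v w : EuclideanSpace ℝ (Fin n)) : EuclideanSpace ℝ (Fin n) :=
  covDeriv G y u (fun z => covDeriv G z v (fun _ => w))
    - covDeriv G y v (fun z => covDeriv G z u (fun _ => w))

/-- The sectional curvature at `y` of the plane spanned by the linearly independent vectors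
`u` and `v`. -/
def sectionalCurvature
    (G : EuclideanSpace ℝ (Fin n) → EuclideanSpace ℝ (Fin n) → EuclideanSpace ℝ (Fin n) → ℝ)
    (y u v : EuclideanSpace ℝ (Fin n)) : ℝ :=
  G y (curvature G y u v v) u / (G y u u * G y v v - G y u v ^ 2)

end CoordMetric

/-! ### Immersions in coordinates

Here `h` is the coordinate expression `f ∘ φ⁻¹` of an immersion `f` into `ℝᵐ`; tangent vectors of
the submanifold are represented by vectors of `ℝⁿ`, and normal vectors by vectors of `ℝᵐ`. -/

namespace CoordImmersion

open CoordMetric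

variable {n m : ℕ}

/-- The metric `⟨u, v⟩_f = ⟨df u, df v⟩` induced by the immersion. -/
def inducedMetric (h : EuclideanSpace ℝ (Fin n) → EuclideanSpace ℝ (Fin m))
    (y u v : EuclideanSpace ℝ (Fin n)) : ℝ :=
  ⟪fderiv ℝ h y u, fderiv ℝ h y v⟫_ℝ

/-- The normal space of the immersion at `y`. -/
def normalSpace (h : EuclideanSpace ℝ (Fin n) → EuclideanSpace ℝ (Fin m))
    (y : EuclideanSpace ℝ (Fin n)) : Submodule ℝ (EuclideanSpace ℝ (Fin m)) :=
  (LinearMap.range (fderiv ℝ h y : EuclideanSpace ℝ (Fin n) →ₗ[ℝ] EuclideanSpace ℝ (Fin m)))ᗮ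

/-- The orthogonal projection of `ℝᵐ` onto the normal space at `y`. -/
def normalPart (h : EuclideanSpace ℝ (Fin n) → EuclideanSpace ℝ (Fin m))
    (y : EuclideanSpace ℝ (Fin n)) : EuclideanSpace ℝ (Fin m) →L[ℝ] EuclideanSpace ℝ (Fin m) :=
  (normalSpace h y).starProjection

/-- The second fundamental form `α(u, v)`: the normal component of the derivative in the direction
`u` of the vector field `df v` along the immersion. -/
def secondFF (h : EuclideanSpace ℝ (Fin n) → EuclideanSpace ℝ (Fin m))
    (y u v : EuclideanSpace ℝ (Fin n)) : EuclideanSpace ℝ (Fin m) :=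
  normalPart h y (fderiv ℝ (fun z => fderiv ℝ h z v) y u)

/-- The mean curvature vector field, `1 / n` times the trace of the second fundamental form. -/
def meanCurvature (h : EuclideanSpace ℝ (Fin n) → EuclideanSpace ℝ (Fin m))
    (y : EuclideanSpace ℝ (Fin n)) : EuclideanSpace ℝ (Fin m) :=
  (1 / (n : ℝ)) • ∑ i, ∑ j,
    invGram (inducedMetric h) y i j • secondFF h y (basisVec i) (basisVec j)

/-- The squared norm `∑ g^{ik} g^{jl} ⟨α_{ij}, α_{kl}⟩` of the second fundamental form with respect
to the induced metric. -/
def secondFFNormSq (h : EuclideanSpace ℝ (Fin n) → EuclideanSpace ℝ (Fin m))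
    (y : EuclideanSpace ℝ (Fin n)) : ℝ :=
  ∑ i, ∑ j, ∑ k, ∑ l,
    invGram (inducedMetric h) y i k * invGram (inducedMetric h) y j l *
      ⟪secondFF h y (basisVec i) (basisVec j), secondFF h y (basisVec k) (basisVec l)⟫_ℝ

/-- The point `y` is umbilical: all of `ℝⁿ` is the eigenspace of one principal normal vector. -/
def IsUmbilicalAt (h : EuclideanSpace ℝ (Fin n) → EuclideanSpace ℝ (Fin m))
    (y : EuclideanSpace ℝ (Fin n)) : Prop :=
  ∃ η ∈ normalSpace h y, ∀ u v, secondFF h y u v = inducedMetric h y u v • η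

/-- The conformal factor `ρ`, where `ρ² = n / (n - 1) * (‖α‖² - n ‖H‖²)`. -/
def moebiusFactor (h : EuclideanSpace ℝ (Fin n) → EuclideanSpace ℝ (Fin m))
    (y : EuclideanSpace ℝ (Fin n)) : ℝ :=
  √((n : ℝ) / ((n : ℝ) - 1) * (secondFFNormSq h y - (n : ℝ) * ‖meanCurvature h y‖ ^ 2))

/-- The Moebius metric `⟨u, v⟩* = ρ² ⟨u, v⟩_f`. -/
def moebiusMetric (h : EuclideanSpace ℝ (Fin n) → EuclideanSpace ℝ (Fin m))
    (y u v : EuclideanSpace ℝ (Fin n)) : ℝ :=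
  moebiusFactor h y ^ 2 * inducedMetric h y u v

/-- The Moebius second fundamental form `β(u, v) = ρ (α(u, v) - ⟨u, v⟩_f H)`. -/
def moebiusSecondFF (h : EuclideanSpace ℝ (Fin n) → EuclideanSpace ℝ (Fin m))
    (y u v : EuclideanSpace ℝ (Fin n)) : EuclideanSpace ℝ (Fin m) :=
  moebiusFactor h y • (secondFF h y u v - inducedMetric h y u v • meanCurvature h y)

/-- The normal connection: `normalDeriv h y u ξ` is `∇⊥_u ξ` at `y`. -/
def normalDeriv (h : EuclideanSpace ℝ (Fin n) → EuclideanSpace ℝ (Fin m))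
    (y u : EuclideanSpace ℝ (Fin n)) (ξ : EuclideanSpace ℝ (Fin n) → EuclideanSpace ℝ (Fin m)) :
    EuclideanSpace ℝ (Fin m) :=
  normalPart h y (fderiv ℝ ξ y u)

/-- The normal curvature `R⊥(u, v) ξ = ∇⊥_u ∇⊥_v ξ - ∇⊥_v ∇⊥_u ξ - ∇⊥_{[u, v]} ξ` at `y`,
for constant coordinate fields `u`, `v` (so that `[u, v] = 0`) and a normal field `ξ`. -/
def normalCurvature (h : EuclideanSpace ℝ (Fin n) → EuclideanSpace ℝ (Fin m))
    (y u v : EuclideanSpace ℝ (Fin n)) (ξ : EuclideanSpace ℝ (Fin n) → EuclideanSpace ℝ (Fin m)) :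
    EuclideanSpace ℝ (Fin m) :=
  normalDeriv h y u (fun z => normalDeriv h z v ξ)
    - normalDeriv h y v (fun z => normalDeriv h z u ξ)

/-- The Moebius form `ω(u) = -(1/ρ) (∇⊥_u H + β(u, grad* ρ))`, a one-form with values in the normal
bundle; `grad*` is the gradient of the Moebius metric. -/
def moebiusForm (h : EuclideanSpace ℝ (Fin n) → EuclideanSpace ℝ (Fin m))
    (y u : EuclideanSpace ℝ (Fin n)) : EuclideanSpace ℝ (Fin m) :=
  -(1 / moebiusFactor h y) •
    (normalDeriv h y u (meanCurvature h)
      + moebiusSecondFF h y u (grad (moebiusMetric h) (moebiusFactor h) y))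

/-- The exterior derivative `dθ(u, v) = ∇⊥_u (θ(v)) - ∇⊥_v (θ(u)) - θ([u, v])` at `y` of a one-form
with values in the normal bundle, for constant coordinate fields `u`, `v`
(so that `[u, v] = 0`). -/
def normalExtDeriv (h : EuclideanSpace ℝ (Fin n) → EuclideanSpace ℝ (Fin m))
    (θ : EuclideanSpace ℝ (Fin n) → EuclideanSpace ℝ (Fin n) → EuclideanSpace ℝ (Fin m))
    (y u v : EuclideanSpace ℝ (Fin n)) : EuclideanSpace ℝ (Fin m) :=
  normalDeriv h y u (fun z => θ z v) - normalDeriv h y v (fun z => θ z u)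

end CoordImmersion

/-! ### Isometric immersions of Riemannian manifolds into Euclidean space

All notions below are local and independent of the coordinates, and are expressed in all charts
`φ` of the (maximal) smooth atlas of `M`, through the coordinate expression `f ∘ φ⁻¹`. -/

section Submanifold

variable {n m : ℕ} {M : Type*} [TopologicalSpace M] [ChartedSpace (EuclideanSpace ℝ (Fin n)) M]

variable (n) in
/-- The differential `df` of `f` at `x`, with values in `ℝᵐ`. -/
def differential (f : M → EuclideanSpace ℝ (Fin m)) (x : M) :
    TangentSpace (𝓡 n) x →L[ℝ] EuclideanSpace ℝ (Fin m) :=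
  mfderiv (𝓡 n) 𝓘(ℝ, EuclideanSpace ℝ (Fin m)) f x

/-- `f` is a smooth isometric immersion of the Riemannian manifold `(M, g)` into `ℝᵐ`. -/
structure IsIsometricImmersion [IsManifold (𝓡 n) ∞ M]
    (g : Bundle.ContMDiffRiemannianMetric (𝓡 n) ∞ (EuclideanSpace ℝ (Fin n))
      (fun x : M => TangentSpace (𝓡 n) x))
    (f : M → EuclideanSpace ℝ (Fin m)) : Prop where
  contMDiff : ContMDiff (𝓡 n) 𝓘(ℝ, EuclideanSpace ℝ (Fin m)) ∞ f
  inner_eq : ∀ (x : M) (u v : TangentSpace (𝓡 n) x),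
    ⟪differential n f x u, differential n f x v⟫_ℝ = g.inner x u v

variable (n) in
/-- `f` has no umbilical points. -/
def IsUmbilicFree (f : M → EuclideanSpace ℝ (Fin m)) : Prop :=
  ∀ φ ∈ IsManifold.maximalAtlas (𝓡 n) ∞ M, ∀ y ∈ φ.target,
    ¬ CoordImmersion.IsUmbilicalAt (f ∘ φ.symm) y

variable (n) in
/-- The Moebius metric of `f` has constant sectional curvature `c`. -/
def HasConstantMoebiusCurvature (f : M → EuclideanSpace ℝ (Fin m)) (c : ℝ) : Prop :=
  ∀ φ ∈ IsManifold.maximalAtlas (𝓡 n) ∞ M, ∀ y ∈ φ.target,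
    ∀ u v : EuclideanSpace ℝ (Fin n), LinearIndependent ℝ ![u, v] →
      CoordMetric.sectionalCurvature (CoordImmersion.moebiusMetric (f ∘ φ.symm)) y u v = c

variable (n) in
/-- The curvature tensor of the normal bundle of `f` vanishes identically. -/
def HasFlatNormalBundle (f : M → EuclideanSpace ℝ (Fin m)) : Prop :=
  ∀ φ ∈ IsManifold.maximalAtlas (𝓡 n) ∞ M,
    ∀ ξ : EuclideanSpace ℝ (Fin n) → EuclideanSpace ℝ (Fin m),
      ContDiffOn ℝ ∞ ξ φ.target →
      (∀ y ∈ φ.target, ξ y ∈ CoordImmersion.normalSpace (f ∘ φ.symm) y) →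
      ∀ y ∈ φ.target, ∀ u v : EuclideanSpace ℝ (Fin n),
        CoordImmersion.normalCurvature (f ∘ φ.symm) y u v ξ = 0

variable (n) in
/-- The Moebius form of `f` is closed. -/
def HasClosedMoebiusForm (f : M → EuclideanSpace ℝ (Fin m)) : Prop :=
  ∀ φ ∈ IsManifold.maximalAtlas (𝓡 n) ∞ M, ∀ y ∈ φ.target,
    ∀ u v : EuclideanSpace ℝ (Fin n),
      CoordImmersion.normalExtDeriv (f ∘ φ.symm)
        (CoordImmersion.moebiusForm (f ∘ φ.symm)) y u v = 0

end Submanifold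

end

/-! ### Orthonormal frames and traces -/

namespace CoordMetric

open Module

variable {n : ℕ} {E F : Type*} [NormedAddCommGroup E] [InnerProductSpace ℝ E]
  [AddCommGroup F] [Module ℝ F]

/-! Write σ = ρ⁻¹ and consider the field ζ = σH − df(grad σ) along the immersion, with values in ℝᵐ
and not normal in general. Since grad*ρ = −grad σ, the form ω(u) is minus the normal part of D_u ζ
(`moebiusForm_eq`). Ordinary second derivatives of ζ commute, so dω only sees the tangential parts
of Dζ: up to sign, dω(u,v) = α(v, Su) − α(u, Sv), where S = σA_H + Hess σ (`normalDeriv_commutator`,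
`inner_fderiv_hessian`). Pairing with a vector ξ, this vanishes once S commutes with every shape
operator A_ξ.

Flatness of the normal bundle gives α(A_ξ u, v) = α(u, A_ξ v) (`exists_shapeOperator_comm`), which
takes care of σA_H. For Hess σ, the Gauss equation of the conformal metric σ⁻²⟨·,·⟩
(`curvature_conformal`) turns constant curvature into an identity relating α and Hess σ. Its trace
expresses (n−2) Hess σ through ⟨α(·,·), tr α⟩, the form ∑ₖ⟨α(·,bₖ), α(·,bₖ)⟩ and the metric, all
compatible with A_ξ; n ≥ 3 allows division by n−2 (`apply_comm_of_curvature`).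

No principal normals are needed, and orthonormal frames are used only at a single point. -/

/-- The basis `b` is orthonormal for the pull-back of the inner product by `A`. -/
def IsFrame {V : Type*} [AddCommGroup V] [Module ℝ V] {ι : Type*} [DecidableEq ι]
    (A : V →ₗ[ℝ] E) (b : Basis ι ℝ V) : Prop :=
  ∀ i j, ⟪A (b i), A (b j)⟫_ℝ = if i = j then 1 else 0

/-- The range of `A` inherits the ambient inner product, and an orthonormal basis of it is pulled
back along `A`. In the applications `A` is df at a point. -/
theorem exists_isFrame (A : EuclideanSpace ℝ (Fin n) →ₗ[ℝ] E) (hA : Function.Injective A) :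
    ∃ b : Basis (Fin n) ℝ (EuclideanSpace ℝ (Fin n)), IsFrame A b := by
  let e := LinearEquiv.ofInjective A hA
  have hd : finrank ℝ (LinearMap.range A) = n := by
    rw [← e.finrank_eq]; simp
  let c := (stdOrthonormalBasis ℝ (LinearMap.range A)).reindex (finCongr hd)
  refine ⟨c.toBasis.map e.symm, fun i j => ?_⟩
  have h : ∀ k, A ((c.toBasis.map e.symm) k) = (c k : E) := fun k => by
    have : ((e (e.symm (c k)) : LinearMap.range A) : E) = A (e.symm (c k)) := rfl
    rw [Basis.map_apply, OrthonormalBasis.coe_toBasis, ← this, LinearEquiv.apply_symm_apply]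
  rw [h, h, ← Submodule.coe_inner]
  exact orthonormal_iff_ite.1 c.orthonormal i j

namespace IsFrame

variable {V : Type*} [AddCommGroup V] [Module ℝ V] {ι : Type*} [Fintype ι] [DecidableEq ι]
  {A : V →ₗ[ℝ] E} {b : Basis ι ℝ V}

theorem repr_apply (hb : IsFrame A b) (v : V) (i : ι) : b.repr v i = ⟪A v, A (b i)⟫_ℝ := by
  conv_rhs => rw [← b.sum_repr v, map_sum, sum_inner]
  simp [inner_smul_left, hb _ _]

theorem sum_inner_smul (hb : IsFrame A b) (v : V) : ∑ i, ⟪A v, A (b i)⟫_ℝ • b i = v := by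
  simp_rw [← hb.repr_apply]
  exact b.sum_repr v

theorem sum_inner_mul_inner (hb : IsFrame A b) (v w : V) :
    ∑ i, ⟪A v, A (b i)⟫_ℝ * ⟪A (b i), A w⟫_ℝ = ⟪A v, A w⟫_ℝ := by
  conv_rhs => rw [← hb.sum_inner_smul v, map_sum, sum_inner]
  simp [inner_smul_left]

theorem sum_inner_mul (hb : IsFrame A b) (l : V →ₗ[ℝ] ℝ) (v : V) :
    ∑ i, ⟪A v, A (b i)⟫_ℝ * l (b i) = l v := by
  conv_rhs => rw [← hb.sum_inner_smul v, map_sum]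
  simp

/-- The trace of a bilinear form composed with a self-adjoint operator. -/
theorem sum_apply_comm (hb : IsFrame A b) (B : V →ₗ[ℝ] V →ₗ[ℝ] F) (T : V →ₗ[ℝ] V)
    (hT : ∀ u v, ⟪A (T u), A v⟫_ℝ = ⟪A u, A (T v)⟫_ℝ) :
    ∑ i, B (T (b i)) (b i) = ∑ i, B (b i) (T (b i)) := by
  have h1 : ∀ i, B (T (b i)) (b i) = ∑ j, ⟪A (T (b i)), A (b j)⟫_ℝ • B (b j) (b i) := fun i => by
    conv_lhs => rw [← hb.sum_inner_smul (T (b i))]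
    simp
  have h2 : ∀ i, B (b i) (T (b i)) = ∑ j, ⟪A (T (b i)), A (b j)⟫_ℝ • B (b i) (b j) := fun i => by
    conv_lhs => rw [← hb.sum_inner_smul (T (b i))]
    simp
  simp_rw [h1, h2]
  -- The coefficients form the matrix of `T` in the frame, which is symmetric, so the two double
  -- sums differ by exchanging indices.
  rw [Finset.sum_comm]
  refine Finset.sum_congr rfl fun i _ => Finset.sum_congr rfl fun j _ => ?_
  rw [hT, real_inner_comm]

end IsFrame

/-! ### Inverse Gram matrix, traces and duals in a frame -/

theorem coord_eq (v : EuclideanSpace ℝ (Fin n)) : ∑ i, v i • basisVec i = v := by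
  have := (EuclideanSpace.basisFun (Fin n) ℝ).sum_repr v
  simpa [basisVec] using this

variable {G : EuclideanSpace ℝ (Fin n) → EuclideanSpace ℝ (Fin n) → EuclideanSpace ℝ (Fin n) → ℝ}
  {y : EuclideanSpace ℝ (Fin n)} {A : EuclideanSpace ℝ (Fin n) →ₗ[ℝ] E}
  {b : Basis (Fin n) ℝ (EuclideanSpace ℝ (Fin n))} {s : ℝ}

/-- The inverse Gram matrix in terms of an orthonormal frame. -/
theorem invGram_eq (hs : s ≠ 0) (hG : ∀ u v, G y u v = s * ⟪A u, A v⟫_ℝ) (hb : IsFrame A b)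
    (i j : Fin n) : invGram G y i j = s⁻¹ * ∑ k, b k i * b k j := by
  have key : (Matrix.of fun i j => s⁻¹ * ∑ k, b k i * b k j) *
      (Matrix.of fun i j => G y (basisVec i) (basisVec j)) = 1 := by
    ext i j
    simp only [Matrix.mul_apply, Matrix.of_apply, hG]
    have h1 : ∀ k, ∑ x, b k x * ⟪A (basisVec x), A (basisVec j)⟫_ℝ
        = ⟪A (b k), A (basisVec j)⟫_ℝ := fun k => by
      conv_rhs => rw [← coord_eq (b k), map_sum, sum_inner]
      simp [inner_smul_left]
    calc ∑ x, s⁻¹ * (∑ k, b k i * b k x) * (s * ⟪A (basisVec x), A (basisVec j)⟫_ℝ)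
        = ∑ x, ∑ k, b k i * (b k x * ⟪A (basisVec x), A (basisVec j)⟫_ℝ) := by
          refine Finset.sum_congr rfl fun x _ => ?_
          rw [mul_mul_mul_comm, inv_mul_cancel₀ hs, one_mul]
          rw [Finset.sum_mul]
          exact Finset.sum_congr rfl fun k _ => by ring
      _ = ∑ k, b k i * ⟪A (b k), A (basisVec j)⟫_ℝ := by
          rw [Finset.sum_comm]
          refine Finset.sum_congr rfl fun k _ => ?_
          rw [← Finset.mul_sum, h1]
      _ = (1 : Matrix (Fin n) (Fin n) ℝ) i j := by
          -- The `i`-th coordinate of the frame expansion of the `j`-th standard basis vector.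
          have h2 := congrArg (fun v : EuclideanSpace ℝ (Fin n) => v i)
            (hb.sum_inner_smul (basisVec j))
          simp only [WithLp.ofLp_sum, WithLp.ofLp_smul, Finset.sum_apply, Pi.smul_apply,
            smul_eq_mul, basisVec, PiLp.single_apply] at h2
          rw [Matrix.one_apply, ← h2]
          refine Finset.sum_congr rfl fun k _ => ?_
          rw [mul_comm, real_inner_comm]
          rfl
  rw [invGram, Matrix.inv_eq_left_inv key, Matrix.of_apply]

/-- Contraction with g^{ij} is the trace over an orthonormal frame. The factor `s` lets one
statement serve both the induced metric (`s = 1`) and metrics conformal to it. -/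
theorem sum_invGram_smul (hs : s ≠ 0) (hG : ∀ u v, G y u v = s * ⟪A u, A v⟫_ℝ) (hb : IsFrame A b)
    (B : EuclideanSpace ℝ (Fin n) →ₗ[ℝ] EuclideanSpace ℝ (Fin n) →ₗ[ℝ] F) :
    ∑ i, ∑ j, invGram G y i j • B (basisVec i) (basisVec j) = s⁻¹ • ∑ k, B (b k) (b k) := by
  have h1 : ∀ k, B (b k) (b k) = ∑ i, ∑ j, (b k i * b k j) • B (basisVec i) (basisVec j) :=
    fun k => by
      conv_lhs => rw [← coord_eq (b k)]
      simp only [map_sum, map_smul, LinearMap.sum_apply, LinearMap.smul_apply, Finset.smul_sum,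
        smul_smul]
      rw [Finset.sum_comm]
      refine Finset.sum_congr rfl fun i _ => Finset.sum_congr rfl fun j _ => ?_
      rw [mul_comm]
  simp_rw [h1, invGram_eq hs hG hb, Finset.smul_sum, Finset.mul_sum, Finset.sum_smul, smul_smul]
  conv_rhs => rw [Finset.sum_comm]
  refine Finset.sum_congr rfl fun i _ => ?_
  rw [Finset.sum_comm]

/-- The trace formula for the vector-valued bilinear form (u, w) ↦ l(w)u. -/
theorem sharp_eq (hs : s ≠ 0) (hG : ∀ u v, G y u v = s * ⟪A u, A v⟫_ℝ) (hb : IsFrame A b)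
    (l : EuclideanSpace ℝ (Fin n) →ₗ[ℝ] ℝ) : sharp G y l = s⁻¹ • ∑ k, l (b k) • b k := by
  have h := sum_invGram_smul hs hG hb
    (LinearMap.mk₂ ℝ (fun u w => l w • u) (fun _ _ _ => smul_add _ _ _)
      (fun _ _ _ => smul_comm _ _ _) (fun _ _ _ => by rw [map_add, add_smul])
      (fun _ _ _ => by rw [map_smul, smul_assoc]))
  simp only [LinearMap.mk₂_apply, smul_smul] at h
  rw [← h]
  simp only [sharp, Finset.sum_smul]

/-- The characterization of the dual vector through which gradients, tangential components and
Christoffel symbols are identified below. -/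
theorem inner_sharp (hs : s ≠ 0) (hG : ∀ u v, G y u v = s * ⟪A u, A v⟫_ℝ)
    (hA : Function.Injective A) (l : EuclideanSpace ℝ (Fin n) →ₗ[ℝ] ℝ)
    (w : EuclideanSpace ℝ (Fin n)) : s * ⟪A (sharp G y l), A w⟫_ℝ = l w := by
  obtain ⟨b, hb⟩ := exists_isFrame A hA
  rw [sharp_eq hs hG hb, ← hb.sum_inner_mul l w]
  simp only [map_smul, map_sum, inner_smul_left, sum_inner]
  simp only [conj_trivial, mul_inv_cancel_left₀ hs]
  exact Finset.sum_congr rfl fun k _ => by rw [mul_comm, real_inner_comm]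

/-- A kernel vector of the Gram matrix would have `A`-image of length zero. -/
theorem det_gram_ne_zero (hs : s ≠ 0) (hG : ∀ u v, G y u v = s * ⟪A u, A v⟫_ℝ)
    (hA : Function.Injective A) :
    (Matrix.of fun i j => G y (basisVec i) (basisVec j)).det ≠ 0 := by
  intro h
  obtain ⟨x, hx, hx'⟩ := Matrix.exists_mulVec_eq_zero_iff.2 h
  apply hx
  have h1 : s * ⟪A (∑ i, x i • basisVec i), A (∑ i, x i • basisVec i)⟫_ℝ = 0 := by
    have : ∀ i, s * ⟪A (basisVec i), A (∑ i, x i • basisVec i)⟫_ℝ = 0 := fun i => by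
      have := congrFun hx' i
      simp only [Matrix.mulVec, dotProduct, Matrix.of_apply, hG, Pi.zero_apply] at this
      rw [← this, map_sum, inner_sum, Finset.mul_sum]
      exact Finset.sum_congr rfl fun j _ => by rw [map_smul, inner_smul_right]; ring
    rw [map_sum, sum_inner, Finset.mul_sum, ← map_sum]
    refine Finset.sum_eq_zero fun i _ => ?_
    rw [map_smul, inner_smul_left, mul_left_comm, this, mul_zero]
  have h2 := hA ((inner_self_eq_zero.1 ((mul_eq_zero.1 h1).resolve_left hs)).trans (map_zero A).symm)
  have h3 := coord_eq (WithLp.toLp 2 x)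
  ext i
  have := congrArg (fun v : EuclideanSpace ℝ (Fin n) => v i) (h3.symm.trans h2)
  simpa using this

/-- Cramer's rule: the entries are cofactors divided by the determinant, and determinants are
polynomial in the entries. -/
theorem contDiffOn_invGram {U : Set (EuclideanSpace ℝ (Fin n))}
    (hG : ∀ u v, ContDiffOn ℝ ∞ (fun z => G z u v) U)
    (hdet : ∀ z ∈ U, (Matrix.of fun i j => G z (basisVec i) (basisVec j)).det ≠ 0)
    (i j : Fin n) : ContDiffOn ℝ ∞ (fun z => invGram G z i j) U := by
  have hd : ∀ M : EuclideanSpace ℝ (Fin n) → Matrix (Fin n) (Fin n) ℝ,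
      (∀ i j, ContDiffOn ℝ ∞ (fun z => M z i j) U) → ContDiffOn ℝ ∞ (fun z => (M z).det) U := by
    intro M hM
    simp only [Matrix.det_apply']
    exact ContDiffOn.sum fun p _ => contDiffOn_const.mul (contDiffOn_prod fun k _ => hM _ _)
  simp only [invGram, Matrix.inv_def, Ring.inverse_eq_inv', Matrix.smul_apply, smul_eq_mul,
    Matrix.adjugate_apply]
  refine ((hd _ fun i j => hG _ _).inv hdet).mul (hd _ fun k l => ?_)
  by_cases hk : k = j
  · subst hk; simp only [Matrix.updateRow_self]; exact contDiffOn_const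
  · simp only [Matrix.updateRow_ne hk]; exact hG _ _

theorem contDiffOn_sharp {U : Set (EuclideanSpace ℝ (Fin n))}
    (hG : ∀ u v, ContDiffOn ℝ ∞ (fun z => G z u v) U)
    (hdet : ∀ z ∈ U, (Matrix.of fun i j => G z (basisVec i) (basisVec j)).det ≠ 0)
    {l : EuclideanSpace ℝ (Fin n) → EuclideanSpace ℝ (Fin n) → ℝ}
    (hl : ∀ w, ContDiffOn ℝ ∞ (fun z => l z w) U) :
    ContDiffOn ℝ ∞ (fun z => sharp G z (l z)) U := by
  unfold sharp
  exact ContDiffOn.sum fun i _ => (ContDiffOn.sum fun j _ =>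
    (contDiffOn_invGram hG hdet i j).mul (hl _)).smul contDiffOn_const

end CoordMetric

/-! ### Algebra of the traced Gauss equation -/

namespace CoordMetric

open Module

section Trace

variable {V E : Type*} [AddCommGroup V] [Module ℝ V] [NormedAddCommGroup E]
  [InnerProductSpace ℝ E] {ι : Type*} [Fintype ι] [DecidableEq ι]
  {A : V →ₗ[ℝ] E} {b : Basis ι ℝ V}

theorem IsFrame.sum_inner_self (hb : IsFrame A b) :
    ∑ i, ⟪A (b i), A (b i)⟫_ℝ = Fintype.card ι := by
  rw [Finset.sum_congr rfl fun i _ => (hb i i).trans (if_pos rfl)]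
  simp

/-- If the quadratic form `S(u, u)` is given by a constant curvature condition, then `S` commutes
with every self-adjoint operator with which `α` commutes. -/
theorem apply_comm_of_curvature (hb : IsFrame A b) (hcard : 3 ≤ Fintype.card ι)
    (α : V →ₗ[ℝ] V →ₗ[ℝ] E) (hα : ∀ u v, α u v = α v u)
    (S : V →ₗ[ℝ] V →ₗ[ℝ] ℝ) (hS : ∀ u v, S u v = S v u) {t κ : ℝ} (ht : t ≠ 0)
    (hK : ∀ u v, LinearIndependent ℝ ![u, v] →
      ⟪α u u, α v v⟫_ℝ - ⟪α u v, α u v⟫_ℝ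
        + t * (S u u * ⟪A v, A v⟫_ℝ + S v v * ⟪A u, A u⟫_ℝ - 2 * S u v * ⟪A u, A v⟫_ℝ)
      = κ * (⟪A u, A u⟫_ℝ * ⟪A v, A v⟫_ℝ - ⟪A u, A v⟫_ℝ ^ 2))
    (T : V →ₗ[ℝ] V) (hT : ∀ u v, ⟪A (T u), A v⟫_ℝ = ⟪A u, A (T v)⟫_ℝ)
    (hTα : ∀ u v, α (T u) v = α u (T v)) (u v : V) : S (T u) v = S u (T v) := by
  -- For dependent pairs both sides vanish, so the identity holds for all pairs and can be traced
  -- and polarized.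
  have hK' : ∀ u v, ⟪α u u, α v v⟫_ℝ - ⟪α u v, α u v⟫_ℝ
        + t * (S u u * ⟪A v, A v⟫_ℝ + S v v * ⟪A u, A u⟫_ℝ - 2 * S u v * ⟪A u, A v⟫_ℝ)
      = κ * (⟪A u, A u⟫_ℝ * ⟪A v, A v⟫_ℝ - ⟪A u, A v⟫_ℝ ^ 2) := by
    intro u v
    by_cases h : LinearIndependent ℝ ![u, v]
    · exact hK u v h
    by_cases hu : u = 0
    · subst hu; simp
    rw [LinearIndependent.pair_iff' hu] at h
    push Not at h
    obtain ⟨a, rfl⟩ := h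
    simp only [map_smul, LinearMap.smul_apply, inner_smul_left, inner_smul_right, conj_trivial,
      smul_eq_mul]
    ring
  set K := ∑ k, α (b k) (b k) with hKdef
  set μ := κ * ((Fintype.card ι : ℝ) - 1) - t * ∑ k, S (b k) (b k) with hμ
  -- Sum the identity over v = bₖ. The S-terms give card · S(u,u) + tr S · |u|² − 2S(u,u); the
  -- multiple of |u|² goes into `μ`.
  have h1 : ∀ u, t * ((Fintype.card ι : ℝ) - 2) * S u u + ⟪α u u, K⟫_ℝ
      - ∑ k, ⟪α u (b k), α u (b k)⟫_ℝ - μ * ⟪A u, A u⟫_ℝ = 0 := by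
    intro u
    have h := Finset.sum_congr rfl (fun k (_ : k ∈ Finset.univ) => hK' u (b k))
    simp only [Finset.sum_add_distrib, Finset.sum_sub_distrib, ← Finset.mul_sum,
      ← Finset.sum_mul, ← inner_sum, ← hKdef] at h
    have h2 := hb.sum_inner_mul (S u) u
    have h3 := hb.sum_inner_mul_inner u u
    have h4 : ∑ k, 2 * S u (b k) * ⟪A u, A (b k)⟫_ℝ = 2 * S u u := by
      rw [← h2, Finset.mul_sum]
      exact Finset.sum_congr rfl fun k _ => by ring
    have h5 : ∑ k, ⟪A u, A (b k)⟫_ℝ ^ 2 = ⟪A u, A u⟫_ℝ := by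
      rw [← h3]
      exact Finset.sum_congr rfl fun k _ => by rw [sq, real_inner_comm (A u) (A (b k))]
    rw [h4, h5, hb.sum_inner_self] at h
    rw [hμ]
    linear_combination h
  -- Polarization of the quadratic identity `h1`.
  have h2 : ∀ u w, t * ((Fintype.card ι : ℝ) - 2) * S u w + ⟪α u w, K⟫_ℝ
      - ∑ k, ⟪α u (b k), α w (b k)⟫_ℝ - μ * ⟪A u, A w⟫_ℝ = 0 := by
    intro u w
    have e1 := h1 (u + w)
    have e2 := h1 u
    have e3 := h1 w
    simp only [map_add, LinearMap.add_apply, inner_add_left, inner_add_right,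
      Finset.sum_add_distrib] at e1
    have e4 : ∑ k, ⟪α w (b k), α u (b k)⟫_ℝ = ∑ k, ⟪α u (b k), α w (b k)⟫_ℝ :=
      Finset.sum_congr rfl fun k _ => real_inner_comm _ _
    rw [e4, hS w u, hα w u, real_inner_comm (A u) (A w)] at e1
    linear_combination (e1 - e2 - e3) / 2
  -- Move `T` from `u` to the frame vector in one factor, across the trace by self-adjointness, and
  -- then onto `v`.
  have h3 : ∑ k, ⟪α (T u) (b k), α v (b k)⟫_ℝ = ∑ k, ⟪α u (b k), α (T v) (b k)⟫_ℝ := by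
    simp_rw [hTα]
    exact hb.sum_apply_comm (((innerₗ E).compl₁₂ (α u) (α v))) T hT
  have e1 := h2 (T u) v
  have e2 := h2 u (T v)
  rw [h3, hTα, hT] at e1
  have hne : t * ((Fintype.card ι : ℝ) - 2) ≠ 0 := by
    refine mul_ne_zero ht ?_
    have : (3 : ℝ) ≤ Fintype.card ι := by exact_mod_cast hcard
    linarith
  exact mul_left_cancel₀ hne (by linear_combination e1 - e2)

end Trace

end CoordMetric

/-! ### Tangential and normal components along an immersion -/

namespace CoordImmersion

open CoordMetric Module

variable {n m : ℕ} {h : EuclideanSpace ℝ (Fin n) → EuclideanSpace ℝ (Fin m)}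
  {U : Set (EuclideanSpace ℝ (Fin n))} {y : EuclideanSpace ℝ (Fin n)}

/-- `h` is a smooth immersion on the open set `U`. -/
structure IsImmersionOn (h : EuclideanSpace ℝ (Fin n) → EuclideanSpace ℝ (Fin m))
    (U : Set (EuclideanSpace ℝ (Fin n))) : Prop where
  isOpen : IsOpen U
  contDiffOn : ContDiffOn ℝ ∞ h U
  injective : ∀ y ∈ U, Function.Injective (fderiv ℝ h y)

/-- The coordinates of the tangential component of a vector of `ℝᵐ`. -/
noncomputable def tangentCoord (h : EuclideanSpace ℝ (Fin n) → EuclideanSpace ℝ (Fin m))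
    (y : EuclideanSpace ℝ (Fin n)) (x : EuclideanSpace ℝ (Fin m)) : EuclideanSpace ℝ (Fin n) :=
  sharp (inducedMetric h) y (fun w => ⟪x, fderiv ℝ h y w⟫_ℝ)

theorem inducedMetric_eq_one_mul (h : EuclideanSpace ℝ (Fin n) → EuclideanSpace ℝ (Fin m))
    (y u v : EuclideanSpace ℝ (Fin n)) : inducedMetric h y u v =
      1 * ⟪(fderiv ℝ h y).toLinearMap u, (fderiv ℝ h y).toLinearMap v⟫_ℝ :=
  (one_mul _).symm

theorem inner_fderiv_tangentCoord (hy : Function.Injective (fderiv ℝ h y))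
    (x : EuclideanSpace ℝ (Fin m)) (w : EuclideanSpace ℝ (Fin n)) :
    ⟪fderiv ℝ h y (tangentCoord h y x), fderiv ℝ h y w⟫_ℝ = ⟪x, fderiv ℝ h y w⟫_ℝ := by
  have := inner_sharp (G := inducedMetric h) (y := y) (A := (fderiv ℝ h y).toLinearMap)
    one_ne_zero (inducedMetric_eq_one_mul h y) hy
    ((innerₗ _ x).comp (fderiv ℝ h y).toLinearMap) w
  rw [one_mul] at this
  exact this

theorem eq_of_inner_fderiv_eq (hy : Function.Injective (fderiv ℝ h y))
    {a b : EuclideanSpace ℝ (Fin n)}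
    (hab : ∀ w, ⟪fderiv ℝ h y a, fderiv ℝ h y w⟫_ℝ = ⟪fderiv ℝ h y b, fderiv ℝ h y w⟫_ℝ) :
    a = b := by
  have h0 : ⟪fderiv ℝ h y (a - b), fderiv ℝ h y (a - b)⟫_ℝ = 0 := by
    conv_lhs => rw [map_sub (fderiv ℝ h y) a b, inner_sub_left, ← map_sub]
    rw [hab, sub_self]
  rw [inner_self_eq_zero, map_sub, sub_eq_zero] at h0
  exact hy h0

theorem mem_normalSpace_iff {x : EuclideanSpace ℝ (Fin m)} :
    x ∈ normalSpace h y ↔ ∀ w, ⟪x, fderiv ℝ h y w⟫_ℝ = 0 := by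
  simp only [normalSpace, Submodule.mem_orthogonal', LinearMap.mem_range]
  constructor
  · exact fun hx w => hx _ ⟨w, rfl⟩
  · rintro hx _ ⟨w, rfl⟩
    exact hx w

theorem normalPart_mem (x : EuclideanSpace ℝ (Fin m)) : normalPart h y x ∈ normalSpace h y :=
  Submodule.starProjection_apply_mem _ _

theorem inner_normalPart_fderiv (x : EuclideanSpace ℝ (Fin m)) (w : EuclideanSpace ℝ (Fin n)) :
    ⟪normalPart h y x, fderiv ℝ h y w⟫_ℝ = 0 :=
  mem_normalSpace_iff.1 (normalPart_mem x) w

theorem inner_fderiv_normalPart (x : EuclideanSpace ℝ (Fin m)) (w : EuclideanSpace ℝ (Fin n)) :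
    ⟪fderiv ℝ h y w, normalPart h y x⟫_ℝ = 0 := by
  rw [real_inner_comm, inner_normalPart_fderiv]

theorem normalPart_of_mem {x : EuclideanSpace ℝ (Fin m)} (hx : x ∈ normalSpace h y) :
    normalPart h y x = x :=
  Submodule.starProjection_eq_self_iff.2 hx

theorem inner_normalPart_comm (x x' : EuclideanSpace ℝ (Fin m)) :
    ⟪normalPart h y x, x'⟫_ℝ = ⟪x, normalPart h y x'⟫_ℝ :=
  Submodule.inner_starProjection_left_eq_right _ _ _

theorem normalPart_fderiv (w : EuclideanSpace ℝ (Fin n)) :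
    normalPart h y (fderiv ℝ h y w) = 0 := by
  rw [← inner_self_eq_zero (𝕜 := ℝ), inner_normalPart_comm, normalPart_of_mem (normalPart_mem _),
    inner_fderiv_normalPart]

/-- This explicit formula for the projection is what yields its smooth dependence on the point. -/
theorem normalPart_eq (hy : Function.Injective (fderiv ℝ h y)) (x : EuclideanSpace ℝ (Fin m)) :
    normalPart h y x = x - fderiv ℝ h y (tangentCoord h y x) := by
  have : x - fderiv ℝ h y (tangentCoord h y x) ∈ normalSpace h y := mem_normalSpace_iff.2
    fun w => by rw [inner_sub_left, inner_fderiv_tangentCoord hy, sub_self]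
  rw [← normalPart_of_mem this, map_sub, normalPart_fderiv, sub_zero]

theorem tangentCoord_add (hy : Function.Injective (fderiv ℝ h y))
    (x x' : EuclideanSpace ℝ (Fin m)) :
    tangentCoord h y (x + x') = tangentCoord h y x + tangentCoord h y x' :=
  eq_of_inner_fderiv_eq hy fun w => by
    simp only [map_add, inner_add_left, inner_fderiv_tangentCoord hy]

theorem tangentCoord_smul (hy : Function.Injective (fderiv ℝ h y))
    (a : ℝ) (x : EuclideanSpace ℝ (Fin m)) :
    tangentCoord h y (a • x) = a • tangentCoord h y x :=
  eq_of_inner_fderiv_eq hy fun w => by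
    simp only [map_smul, inner_smul_left, inner_fderiv_tangentCoord hy]

namespace IsImmersionOn

variable (H : IsImmersionOn h U)
include H

theorem contDiffOn_fderiv : ContDiffOn ℝ ∞ (fderiv ℝ h) U :=
  H.contDiffOn.fderiv_of_isOpen H.isOpen le_rfl

theorem contDiffOn_fderiv_fderiv : ContDiffOn ℝ ∞ (fderiv ℝ (fderiv ℝ h)) U :=
  H.contDiffOn_fderiv.fderiv_of_isOpen H.isOpen le_rfl

theorem contDiffOn_fderiv_apply {W : EuclideanSpace ℝ (Fin n) → EuclideanSpace ℝ (Fin n)}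
    (hW : ContDiffOn ℝ ∞ W U) : ContDiffOn ℝ ∞ (fun z => fderiv ℝ h z (W z)) U :=
  H.contDiffOn_fderiv.clm_apply hW

theorem contDiffOn_inducedMetric (u v : EuclideanSpace ℝ (Fin n)) :
    ContDiffOn ℝ ∞ (fun z => inducedMetric h z u v) U :=
  (H.contDiffOn_fderiv_apply contDiffOn_const).inner ℝ (H.contDiffOn_fderiv_apply contDiffOn_const)

theorem det_gram_ne_zero (hy : y ∈ U) :
    (Matrix.of fun i j => inducedMetric h y (basisVec i) (basisVec j)).det ≠ 0 :=
  CoordMetric.det_gram_ne_zero (A := (fderiv ℝ h y).toLinearMap) one_ne_zero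
    (inducedMetric_eq_one_mul h y) (H.injective y hy)

theorem contDiffOn_tangentCoord {x : EuclideanSpace ℝ (Fin n) → EuclideanSpace ℝ (Fin m)}
    (hx : ContDiffOn ℝ ∞ x U) : ContDiffOn ℝ ∞ (fun z => tangentCoord h z (x z)) U :=
  contDiffOn_sharp H.contDiffOn_inducedMetric (fun _ => H.det_gram_ne_zero)
    fun _ => hx.inner ℝ (H.contDiffOn_fderiv_apply contDiffOn_const)

theorem contDiffOn_normalPart {x : EuclideanSpace ℝ (Fin n) → EuclideanSpace ℝ (Fin m)}
    (hx : ContDiffOn ℝ ∞ x U) : ContDiffOn ℝ ∞ (fun z => normalPart h z (x z)) U :=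
  (hx.sub (H.contDiffOn_fderiv_apply (H.contDiffOn_tangentCoord hx))).congr
    fun z hz => normalPart_eq (H.injective z hz) _

theorem differentiableAt_fderiv (hy : y ∈ U) : DifferentiableAt ℝ (fderiv ℝ h) y :=
  (H.contDiffOn_fderiv.differentiableOn (by simp)).differentiableAt (H.isOpen.mem_nhds hy)

theorem differentiableAt {F : Type*} [NormedAddCommGroup F] [NormedSpace ℝ F]
    {x : EuclideanSpace ℝ (Fin n) → F} (hx : ContDiffOn ℝ ∞ x U) (hy : y ∈ U) :
    DifferentiableAt ℝ x y :=
  (hx.differentiableOn (by simp)).differentiableAt (H.isOpen.mem_nhds hy)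

theorem fderiv_fderiv_comm (hy : y ∈ U) (u v : EuclideanSpace ℝ (Fin n)) :
    fderiv ℝ (fderiv ℝ h) y u v = fderiv ℝ (fderiv ℝ h) y v u :=
  ((H.contDiffOn.contDiffAt (H.isOpen.mem_nhds hy)).isSymmSndFDerivAt (by simp; norm_cast)).eq u v

theorem fderiv_fderiv_apply (hy : y ∈ U) (u v : EuclideanSpace ℝ (Fin n)) :
    fderiv ℝ (fun z => fderiv ℝ h z v) y u = fderiv ℝ (fderiv ℝ h) y u v := by
  rw [fderiv_clm_apply (H.differentiableAt_fderiv hy) (differentiableAt_const v)]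
  simp

theorem secondFF_eq (hy : y ∈ U) (u v : EuclideanSpace ℝ (Fin n)) :
    secondFF h y u v = normalPart h y (fderiv ℝ (fderiv ℝ h) y u v) := by
  rw [secondFF, H.fderiv_fderiv_apply hy]

/-- The Gauss formula for a tangent field. -/
theorem normalDeriv_fderiv {W : EuclideanSpace ℝ (Fin n) → EuclideanSpace ℝ (Fin n)}
    (hW : ContDiffOn ℝ ∞ W U) (hy : y ∈ U) (u : EuclideanSpace ℝ (Fin n)) :
    normalDeriv h y u (fun z => fderiv ℝ h z (W z)) = secondFF h y u (W y) := by
  rw [normalDeriv, fderiv_clm_apply (H.differentiableAt_fderiv hy) (H.differentiableAt hW hy),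
    H.secondFF_eq hy]
  simp [normalPart_fderiv]

theorem contDiffOn_fderiv_const {F : Type*} [NormedAddCommGroup F] [NormedSpace ℝ F]
    {x : EuclideanSpace ℝ (Fin n) → F} (hx : ContDiffOn ℝ ∞ x U) (v : EuclideanSpace ℝ (Fin n)) :
    ContDiffOn ℝ ∞ (fun z => fderiv ℝ x z v) U :=
  (hx.fderiv_of_isOpen H.isOpen le_rfl).clm_apply contDiffOn_const

theorem fderiv_fderiv_apply_comm {F : Type*} [NormedAddCommGroup F] [NormedSpace ℝ F]
    {x : EuclideanSpace ℝ (Fin n) → F} (hx : ContDiffOn ℝ ∞ x U) (hy : y ∈ U)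
    (u v : EuclideanSpace ℝ (Fin n)) :
    fderiv ℝ (fun z => fderiv ℝ x z v) y u = fderiv ℝ (fun z => fderiv ℝ x z u) y v := by
  have hd := H.differentiableAt (hx.fderiv_of_isOpen H.isOpen le_rfl) hy
  rw [fderiv_clm_apply hd (differentiableAt_const v), fderiv_clm_apply hd (differentiableAt_const u)]
  simpa using ((hx.contDiffAt (H.isOpen.mem_nhds hy)).isSymmSndFDerivAt
    (by simp; norm_cast)).eq u v

/-- The commutator of normal derivatives of an arbitrary field along the immersion. -/
theorem normalDeriv_commutator {ζ : EuclideanSpace ℝ (Fin n) → EuclideanSpace ℝ (Fin m)}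
    (hζ : ContDiffOn ℝ ∞ ζ U) (hy : y ∈ U) (u v : EuclideanSpace ℝ (Fin n)) :
    normalDeriv h y u (fun z => normalDeriv h z v ζ)
      - normalDeriv h y v (fun z => normalDeriv h z u ζ)
    = secondFF h y v (tangentCoord h y (fderiv ℝ ζ y u))
      - secondFF h y u (tangentCoord h y (fderiv ℝ ζ y v)) := by
  have key : ∀ u v, normalDeriv h y u (fun z => normalDeriv h z v ζ)
      = normalPart h y (fderiv ℝ (fun z => fderiv ℝ ζ z v) y u)
        - secondFF h y u (tangentCoord h y (fderiv ℝ ζ y v)) := by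
    intro u v
    have h1 := H.contDiffOn_tangentCoord (H.contDiffOn_fderiv_const hζ v)
    -- The inner normal derivative is the full derivative minus a tangent field; the Gauss formula
    -- handles the latter, and the full second derivatives cancel in the commutator.
    have h2 : (fun z => normalDeriv h z v ζ) =ᶠ[nhds y]
        fun z => fderiv ℝ ζ z v - fderiv ℝ h z (tangentCoord h z (fderiv ℝ ζ z v)) :=
      Filter.eventuallyEq_of_mem (H.isOpen.mem_nhds hy)
        fun z hz => normalPart_eq (H.injective z hz) _
    rw [← H.normalDeriv_fderiv h1 hy, normalDeriv, h2.fderiv_eq,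
      fderiv_fun_sub (H.differentiableAt (H.contDiffOn_fderiv_const hζ v) hy)
        (H.differentiableAt (H.contDiffOn_fderiv_apply h1) hy)]
    simp [normalDeriv]
  rw [key, key, H.fderiv_fderiv_apply_comm hζ hy]
  abel

end IsImmersionOn

end CoordImmersion

/-! ### Hessian, Moebius factor and Moebius form -/

namespace CoordImmersion

open CoordMetric Module

variable {n m : ℕ} {h : EuclideanSpace ℝ (Fin n) → EuclideanSpace ℝ (Fin m)}
  {U : Set (EuclideanSpace ℝ (Fin n))} {y : EuclideanSpace ℝ (Fin n)}

/-- The second fundamental form as a bilinear map. -/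
noncomputable def secondFFBilin (h : EuclideanSpace ℝ (Fin n) → EuclideanSpace ℝ (Fin m))
    (y : EuclideanSpace ℝ (Fin n)) :
    EuclideanSpace ℝ (Fin n) →ₗ[ℝ] EuclideanSpace ℝ (Fin n) →ₗ[ℝ] EuclideanSpace ℝ (Fin m) :=
  LinearMap.mk₂ ℝ (fun u v => normalPart h y (fderiv ℝ (fderiv ℝ h) y u v))
    (by simp) (by simp) (by simp) (by simp)

theorem secondFFBilin_apply (u v : EuclideanSpace ℝ (Fin n)) :
    secondFFBilin h y u v = normalPart h y (fderiv ℝ (fderiv ℝ h) y u v) := rfl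

/-- The Hessian of `r` with respect to the induced metric, as a bilinear form. -/
noncomputable def hessian (h : EuclideanSpace ℝ (Fin n) → EuclideanSpace ℝ (Fin m))
    (r : EuclideanSpace ℝ (Fin n) → ℝ) (y : EuclideanSpace ℝ (Fin n)) :
    EuclideanSpace ℝ (Fin n) →ₗ[ℝ] EuclideanSpace ℝ (Fin n) →ₗ[ℝ] ℝ :=
  LinearMap.mk₂ ℝ (fun u v => fderiv ℝ (fderiv ℝ r) y u v
      - ⟪fderiv ℝ h y (grad (inducedMetric h) r y), fderiv ℝ (fderiv ℝ h) y u v⟫_ℝ)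
    (fun _ _ _ => by simp only [map_add, add_apply, inner_add_right]; ring)
    (fun _ _ _ => by
      simp only [map_smul, smul_apply, inner_smul_right, smul_eq_mul]; ring)
    (fun _ _ _ => by simp only [map_add, inner_add_right]; ring)
    (fun _ _ _ => by simp only [map_smul, inner_smul_right, smul_eq_mul]; ring)

/-- The subtracted term is dr(∇_u v) for constant fields: df(∇_u v) is the tangential part of D²h(u,
v). -/
theorem hessian_apply (r : EuclideanSpace ℝ (Fin n) → ℝ) (u v : EuclideanSpace ℝ (Fin n)) :
    hessian h r y u v = fderiv ℝ (fderiv ℝ r) y u v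
      - ⟪fderiv ℝ h y (grad (inducedMetric h) r y), fderiv ℝ (fderiv ℝ h) y u v⟫_ℝ := rfl

theorem inner_fderiv_grad (hy : Function.Injective (fderiv ℝ h y))
    (r : EuclideanSpace ℝ (Fin n) → ℝ) (w : EuclideanSpace ℝ (Fin n)) :
    ⟪fderiv ℝ h y (grad (inducedMetric h) r y), fderiv ℝ h y w⟫_ℝ = fderiv ℝ r y w := by
  have := inner_sharp (G := inducedMetric h) (y := y) (A := (fderiv ℝ h y).toLinearMap)
    one_ne_zero (inducedMetric_eq_one_mul h y) hy (fderiv ℝ r y).toLinearMap w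
  rw [one_mul] at this
  exact this

theorem moebiusMetric_eq (y u v : EuclideanSpace ℝ (Fin n)) : moebiusMetric h y u v =
    moebiusFactor h y ^ 2 * ⟪(fderiv ℝ h y).toLinearMap u, (fderiv ℝ h y).toLinearMap v⟫_ℝ :=
  rfl

theorem inner_fderiv_grad_moebiusMetric (hy : Function.Injective (fderiv ℝ h y))
    (hρ : moebiusFactor h y ≠ 0) (r : EuclideanSpace ℝ (Fin n) → ℝ)
    (w : EuclideanSpace ℝ (Fin n)) :
    moebiusFactor h y ^ 2 * ⟪fderiv ℝ h y (grad (moebiusMetric h) r y), fderiv ℝ h y w⟫_ℝ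
      = fderiv ℝ r y w :=
  inner_sharp (G := moebiusMetric h) (y := y) (A := (fderiv ℝ h y).toLinearMap)
    (pow_ne_zero 2 hρ) (moebiusMetric_eq y) hy (fderiv ℝ r y).toLinearMap w

theorem meanCurvature_mem : meanCurvature h y ∈ normalSpace h y :=
  Submodule.smul_mem _ _ (Submodule.sum_mem _ fun _ _ => Submodule.sum_mem _ fun _ _ =>
    Submodule.smul_mem _ _ (normalPart_mem _))

/-- The field `r H - grad r` along the immersion. For `r = ρ⁻¹` its normal derivative is the
Moebius form up to sign. -/
noncomputable def formPotential (h : EuclideanSpace ℝ (Fin n) → EuclideanSpace ℝ (Fin m))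
    (r : EuclideanSpace ℝ (Fin n) → ℝ) (z : EuclideanSpace ℝ (Fin n)) :
    EuclideanSpace ℝ (Fin m) :=
  r z • meanCurvature h z - fderiv ℝ h z (grad (inducedMetric h) r z)

namespace IsImmersionOn

variable (H : IsImmersionOn h U)
include H

theorem secondFF_eq_bilin (hy : y ∈ U) (u v : EuclideanSpace ℝ (Fin n)) :
    secondFF h y u v = secondFFBilin h y u v :=
  H.secondFF_eq hy u v

theorem secondFFBilin_comm (hy : y ∈ U) (u v : EuclideanSpace ℝ (Fin n)) :
    secondFFBilin h y u v = secondFFBilin h y v u := by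
  rw [secondFFBilin_apply, H.fderiv_fderiv_comm hy, secondFFBilin_apply]

theorem contDiffOn_secondFF (u v : EuclideanSpace ℝ (Fin n)) :
    ContDiffOn ℝ ∞ (fun z => secondFF h z u v) U :=
  H.contDiffOn_normalPart (H.contDiffOn_fderiv_const
    (H.contDiffOn_fderiv_apply contDiffOn_const) u)

theorem contDiffOn_invGram (i j : Fin n) :
    ContDiffOn ℝ ∞ (fun z => invGram (inducedMetric h) z i j) U :=
  CoordMetric.contDiffOn_invGram H.contDiffOn_inducedMetric (fun _ => H.det_gram_ne_zero) i j

theorem contDiffOn_meanCurvature : ContDiffOn ℝ ∞ (meanCurvature h) U :=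
  contDiffOn_const.fun_smul (ContDiffOn.sum fun i _ => ContDiffOn.sum fun j _ =>
    (H.contDiffOn_invGram i j).fun_smul (H.contDiffOn_secondFF (basisVec i) (basisVec j)))

theorem contDiffOn_secondFFNormSq : ContDiffOn ℝ ∞ (secondFFNormSq h) U :=
  ContDiffOn.sum fun _ _ => ContDiffOn.sum fun _ _ => ContDiffOn.sum fun _ _ =>
    ContDiffOn.sum fun _ _ => ((H.contDiffOn_invGram _ _).mul (H.contDiffOn_invGram _ _)).mul
      ((H.contDiffOn_secondFF _ _).inner ℝ (H.contDiffOn_secondFF _ _))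

theorem contDiffOn_grad {r : EuclideanSpace ℝ (Fin n) → ℝ} (hr : ContDiffOn ℝ ∞ r U) :
    ContDiffOn ℝ ∞ (grad (inducedMetric h) r) U :=
  contDiffOn_sharp H.contDiffOn_inducedMetric (fun _ => H.det_gram_ne_zero)
    fun w => H.contDiffOn_fderiv_const hr w

theorem hessian_comm {r : EuclideanSpace ℝ (Fin n) → ℝ} (hr : ContDiffOn ℝ ∞ r U) (hy : y ∈ U)
    (u v : EuclideanSpace ℝ (Fin n)) : hessian h r y u v = hessian h r y v u := by
  have := ((hr.contDiffAt (H.isOpen.mem_nhds hy)).isSymmSndFDerivAt (by simp; norm_cast)).eq u v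
  rw [hessian_apply, hessian_apply, H.fderiv_fderiv_comm hy, this]

theorem contDiffOn_formPotential {r : EuclideanSpace ℝ (Fin n) → ℝ} (hr : ContDiffOn ℝ ∞ r U) :
    ContDiffOn ℝ ∞ (formPotential h r) U :=
  (hr.fun_smul H.contDiffOn_meanCurvature).sub
    (H.contDiffOn_fderiv_apply (H.contDiffOn_grad hr))

section Frame

variable {b : Basis (Fin n) ℝ (EuclideanSpace ℝ (Fin n))}

theorem meanCurvature_eq (hy : y ∈ U) (hb : IsFrame (fderiv ℝ h y).toLinearMap b) :
    meanCurvature h y = (1 / (n : ℝ)) • ∑ k, secondFFBilin h y (b k) (b k) := by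
  have := sum_invGram_smul one_ne_zero (inducedMetric_eq_one_mul h y) hb (secondFFBilin h y)
  rw [inv_one, one_smul] at this
  rw [meanCurvature, ← this]
  simp_rw [H.secondFF_eq_bilin hy]

theorem secondFFNormSq_eq (hy : y ∈ U) (hb : IsFrame (fderiv ℝ h y).toLinearMap b) :
    secondFFNormSq h y = ∑ k, ∑ l, ‖secondFFBilin h y (b k) (b l)‖ ^ 2 := by
  have h1 : ∀ u v, ∑ j, ∑ l, invGram (inducedMetric h) y j l •
      ⟪secondFFBilin h y u (basisVec j), secondFFBilin h y v (basisVec l)⟫_ℝ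
      = ∑ q, ⟪secondFFBilin h y u (b q), secondFFBilin h y v (b q)⟫_ℝ := fun u v => by
    have := sum_invGram_smul one_ne_zero (inducedMetric_eq_one_mul h y) hb
      ((innerₗ _).compl₁₂ (secondFFBilin h y u) (secondFFBilin h y v))
    rw [inv_one, one_smul] at this
    exact this
  have h2 : ∀ q, ∑ i, ∑ k, invGram (inducedMetric h) y i k •
      ⟪secondFFBilin h y (basisVec i) (b q), secondFFBilin h y (basisVec k) (b q)⟫_ℝ
      = ∑ p, ⟪secondFFBilin h y (b p) (b q), secondFFBilin h y (b p) (b q)⟫_ℝ := fun q => by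
    have := sum_invGram_smul one_ne_zero (inducedMetric_eq_one_mul h y) hb
      ((innerₗ _).compl₁₂ ((secondFFBilin h y).flip (b q)) ((secondFFBilin h y).flip (b q)))
    rw [inv_one, one_smul] at this
    exact this
  calc secondFFNormSq h y
      = ∑ i, ∑ k, invGram (inducedMetric h) y i k • ∑ j, ∑ l, invGram (inducedMetric h) y j l •
        ⟪secondFFBilin h y (basisVec i) (basisVec j),
          secondFFBilin h y (basisVec k) (basisVec l)⟫_ℝ := by
        simp only [secondFFNormSq, H.secondFF_eq_bilin hy, smul_eq_mul, Finset.mul_sum]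
        refine Finset.sum_congr rfl fun i _ => ?_
        rw [Finset.sum_comm]
        simp only [mul_assoc]
    _ = ∑ q, ∑ p, ⟪secondFFBilin h y (b p) (b q), secondFFBilin h y (b p) (b q)⟫_ℝ := by
        simp_rw [h1, ← h2, Finset.smul_sum]
        rw [Finset.sum_comm_cycle]
    _ = _ := by
        rw [Finset.sum_comm]
        simp only [real_inner_self_eq_norm_sq]

/-- The sum on the right is the squared norm of the traceless part of α; the cross terms are
evaluated by ∑ₖ⟨α(bₖ,bₖ), H⟩ = n‖H‖². It makes visible that ρ vanishes only at umbilical points. -/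
theorem secondFFNormSq_sub_eq (hn : n ≠ 0) (hy : y ∈ U)
    (hb : IsFrame (fderiv ℝ h y).toLinearMap b) :
    secondFFNormSq h y - n * ‖meanCurvature h y‖ ^ 2 = ∑ k, ∑ l,
      ‖secondFFBilin h y (b k) (b l) - (if k = l then (1 : ℝ) else 0) • meanCurvature h y‖ ^ 2 := by
  have hn' : (n : ℝ) ≠ 0 := Nat.cast_ne_zero.2 hn
  have h1 : ∑ k, ⟪secondFFBilin h y (b k) (b k), meanCurvature h y⟫_ℝ
      = n * ‖meanCurvature h y‖ ^ 2 := by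
    have : ∑ k, secondFFBilin h y (b k) (b k) = (n : ℝ) • meanCurvature h y := by
      rw [H.meanCurvature_eq hy hb, smul_smul, mul_one_div_cancel hn', one_smul]
    rw [← sum_inner, this, inner_smul_left, conj_trivial, real_inner_self_eq_norm_sq]
  rw [H.secondFFNormSq_eq hy hb]
  simp only [norm_sub_sq_real, Finset.sum_add_distrib, Finset.sum_sub_distrib, inner_smul_right,
    norm_smul, ← Finset.mul_sum, ite_mul, one_mul, zero_mul, Finset.sum_ite_eq, Finset.mem_univ,
    if_true, h1, apply_ite norm, norm_one, norm_zero, apply_ite (fun x : ℝ => x ^ 2)]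
  simp
  ring

end Frame

theorem moebiusFactor_sq_pos (hn : 2 ≤ n) (hy : y ∈ U) (hu : ¬ IsUmbilicalAt h y) :
    0 < (n : ℝ) / ((n : ℝ) - 1) * (secondFFNormSq h y - (n : ℝ) * ‖meanCurvature h y‖ ^ 2) := by
  have hn' : (2 : ℝ) ≤ n := by exact_mod_cast hn
  refine mul_pos (div_pos (by linarith) (by linarith)) ?_
  obtain ⟨b, hb⟩ := exists_isFrame (fderiv ℝ h y).toLinearMap (H.injective y hy)
  rw [H.secondFFNormSq_sub_eq (by omega) hy hb]
  refine lt_of_le_of_ne (by positivity) fun h0 => hu ?_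
  have h1 : ∀ k l, secondFFBilin h y (b k) (b l)
      = (if k = l then (1 : ℝ) else 0) • meanCurvature h y := by
    intro k l
    have := (Finset.sum_eq_zero_iff_of_nonneg fun i _ => by positivity).1 h0.symm k
      (Finset.mem_univ _)
    have := (Finset.sum_eq_zero_iff_of_nonneg fun i _ => by positivity).1 this l
      (Finset.mem_univ _)
    exact sub_eq_zero.1 (norm_eq_zero.1 (pow_eq_zero_iff two_ne_zero |>.1 this))
  refine ⟨meanCurvature h y, meanCurvature_mem, fun u v => ?_⟩
  -- Once the traceless part is zero, α and ⟨·,·⟩H are bilinear maps agreeing on a frame, so H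
  -- itself is the umbilical normal.
  have h2 : secondFFBilin h y = ((innerₗ (EuclideanSpace ℝ (Fin m))).compl₁₂
      (fderiv ℝ h y).toLinearMap (fderiv ℝ h y).toLinearMap).compr₂
        (LinearMap.toSpanSingleton ℝ _ (meanCurvature h y)) := by
    refine b.ext fun k => b.ext fun l => ?_
    rw [h1, ← hb k l]
    rfl
  rw [H.secondFF_eq_bilin hy, h2]
  rfl

theorem moebiusFactor_pos (hn : 2 ≤ n) (hy : y ∈ U) (hu : ¬ IsUmbilicalAt h y) :
    0 < moebiusFactor h y :=
  Real.sqrt_pos.2 (H.moebiusFactor_sq_pos hn hy hu)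

/-- The square root is smooth because its argument stays positive away from umbilical points. -/
theorem contDiffOn_moebiusFactor (hn : 2 ≤ n) (hu : ∀ y ∈ U, ¬ IsUmbilicalAt h y) :
    ContDiffOn ℝ ∞ (moebiusFactor h) U :=
  (contDiffOn_const.mul (H.contDiffOn_secondFFNormSq.sub
    (contDiffOn_const.mul (H.contDiffOn_meanCurvature.norm_sq ℝ)))).sqrt
      fun z hz => (H.moebiusFactor_sq_pos hn hz (hu z hz)).ne'

/-- The Ricci equation of an immersion with flat normal bundle, for the shape operator `T` in the
direction `ξ`. -/
theorem exists_shapeOperator_comm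
    (hflat : ∀ ξ : EuclideanSpace ℝ (Fin n) → EuclideanSpace ℝ (Fin m), ContDiffOn ℝ ∞ ξ U →
      (∀ y ∈ U, ξ y ∈ normalSpace h y) → ∀ y ∈ U, ∀ u v, normalCurvature h y u v ξ = 0)
    (hy : y ∈ U) (ξ : EuclideanSpace ℝ (Fin m)) :
    ∃ T : EuclideanSpace ℝ (Fin n) →ₗ[ℝ] EuclideanSpace ℝ (Fin n),
      (∀ u v, ⟪fderiv ℝ h y (T u), fderiv ℝ h y v⟫_ℝ = ⟪secondFFBilin h y u v, ξ⟫_ℝ) ∧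
      ∀ u v, secondFFBilin h y (T u) v = secondFFBilin h y u (T v) := by
  have hy' := H.injective y hy
  have hs : ContDiffOn ℝ ∞ (fun z => normalPart h z ξ) U :=
    H.contDiffOn_normalPart contDiffOn_const
  -- Weingarten formula: extend ξ to the normal field z ↦ `normalPart h z ξ` and take minus the
  -- tangential part of its derivative.
  refine ⟨-⟨⟨fun u => tangentCoord h y (fderiv ℝ (fun z => normalPart h z ξ) y u),
    fun u v => by rw [map_add, tangentCoord_add hy']⟩,
    fun a u => by
      change tangentCoord h y _ = a • tangentCoord h y _
      rw [map_smul, tangentCoord_smul hy']⟩, fun u v => ?_, fun u v => ?_⟩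
  · change ⟪fderiv ℝ h y (-tangentCoord h y _), _⟫_ℝ = _
    rw [map_neg, inner_neg_left, inner_fderiv_tangentCoord hy', secondFFBilin_apply,
      inner_normalPart_comm]
    -- Differentiating this orthogonality relation gives ⟨Tu, v⟩ = ⟨α(u,v), ξ⟩.
    have h1 : (fun z => ⟪normalPart h z ξ, fderiv ℝ h z v⟫_ℝ) = fun _ => 0 :=
      funext fun z => inner_normalPart_fderiv _ _
    have h2 := fderiv_inner_apply ℝ (H.differentiableAt hs hy)
      (H.differentiableAt (H.contDiffOn_fderiv_apply (contDiffOn_const (c := v))) hy) u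
    rw [h1, H.fderiv_fderiv_apply hy, fderiv_fun_const, Pi.zero_apply,
      zero_apply] at h2
    rw [real_inner_comm (normalPart h y ξ)]
    linarith
  -- For this normal field the commutator is the normal curvature, hence zero.
  · have h1 := H.normalDeriv_commutator hs hy u v
    have h2 := hflat _ hs (fun z _ => normalPart_mem _) y hy u v
    rw [normalCurvature] at h2
    rw [h2, H.secondFF_eq_bilin hy, H.secondFF_eq_bilin hy, eq_comm, sub_eq_zero] at h1
    change secondFFBilin h y (-tangentCoord h y _) v = secondFFBilin h y u (-tangentCoord h y _)
    rw [map_neg, map_neg, LinearMap.neg_apply, ← h1, H.secondFFBilin_comm hy]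

/-- The Moebius form is a normal derivative of a field along the immersion. -/
theorem moebiusForm_eq (hn : 2 ≤ n) (hu : ∀ y ∈ U, ¬ IsUmbilicalAt h y) (hy : y ∈ U)
    (u : EuclideanSpace ℝ (Fin n)) :
    moebiusForm h y u = -normalDeriv h y u (formPotential h fun x => (moebiusFactor h x)⁻¹) := by
  have hy' := H.injective y hy
  have hρ := H.moebiusFactor_pos hn hy (hu y hy)
  have hs := H.contDiffOn_moebiusFactor hn hu
  have hσ : ContDiffOn ℝ ∞ (fun x => (moebiusFactor h x)⁻¹) U :=
    hs.inv fun z hz => (H.moebiusFactor_pos hn hz (hu z hz)).ne'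
  have hH := H.contDiffOn_meanCurvature
  have hW := H.contDiffOn_grad hσ
  -- grad*ρ = ρ⁻² grad ρ = −grad(ρ⁻¹).
  have hg : grad (moebiusMetric h) (moebiusFactor h) y
      = -grad (inducedMetric h) (fun x => (moebiusFactor h x)⁻¹) y := by
    refine eq_of_inner_fderiv_eq hy' fun w => ?_
    have h1 := inner_fderiv_grad_moebiusMetric hy' hρ.ne' (moebiusFactor h) w
    have h2 : fderiv ℝ (fun x => (moebiusFactor h x)⁻¹) y
        = -(moebiusFactor h y ^ 2)⁻¹ • fderiv ℝ (moebiusFactor h) y :=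
      ((hasDerivAt_inv hρ.ne').comp_hasFDerivAt y
        (H.differentiableAt hs hy).hasFDerivAt).fderiv
    rw [map_neg, inner_neg_left, inner_fderiv_grad hy', h2, smul_apply, ← h1, smul_eq_mul]
    field_simp
  have h1 := H.normalDeriv_fderiv hW hy u
  rw [normalDeriv] at h1
  unfold formPotential
  rw [normalDeriv, fderiv_fun_sub (H.differentiableAt (hσ.fun_smul hH) hy)
    (H.differentiableAt (H.contDiffOn_fderiv_apply hW) hy), sub_apply,
    map_sub, h1, fderiv_fun_smul (H.differentiableAt hσ hy) (H.differentiableAt hH hy)]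
  rw [moebiusForm, moebiusSecondFF, hg, normalDeriv, inducedMetric, map_neg, inner_neg_right,
    real_inner_comm, inner_fderiv_grad hy', H.secondFF_eq_bilin hy, H.secondFF_eq_bilin hy,
    map_neg]
  simp only [add_apply, smul_apply,
    ContinuousLinearMap.smulRight_apply, map_add, map_smul,
    normalPart_of_mem meanCurvature_mem]
  match_scalars <;> field_simp

/-- As H is normal, ⟨rH − df(grad r), df v⟩ = −dr(v); differentiate along u. So the tangential part
of the derivative is −(rA_H + Hess r). -/
theorem inner_fderiv_hessian {r : EuclideanSpace ℝ (Fin n) → ℝ} (hr : ContDiffOn ℝ ∞ r U)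
    (hy : y ∈ U) (u v : EuclideanSpace ℝ (Fin n)) :
    ⟪fderiv ℝ (formPotential h r) y u, fderiv ℝ h y v⟫_ℝ
    = -(r y * ⟪meanCurvature h y, secondFFBilin h y u v⟫_ℝ + hessian h r y u v) := by
  have h1 : (fun z => ⟪formPotential h r z, fderiv ℝ h z v⟫_ℝ) =ᶠ[nhds y]
      fun z => -fderiv ℝ r z v :=
    Filter.eventuallyEq_of_mem (H.isOpen.mem_nhds hy) fun z hz => by
      simp only [formPotential]
      rw [inner_sub_left, inner_fderiv_grad (H.injective z hz), inner_smul_left,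
        mem_normalSpace_iff.1 meanCurvature_mem]
      simp
  have h2 := fderiv_inner_apply ℝ (H.differentiableAt (H.contDiffOn_formPotential hr) hy)
    (H.differentiableAt (H.contDiffOn_fderiv_apply (contDiffOn_const (c := v))) hy) u
  have h3 : fderiv ℝ (fun z => -fderiv ℝ r z v) y u = -fderiv ℝ (fderiv ℝ r) y u v := by
    rw [fderiv_fun_neg, neg_apply, fderiv_clm_apply (H.differentiableAt
      (hr.fderiv_of_isOpen H.isOpen le_rfl) hy) (differentiableAt_const v)]
    simp
  rw [h1.fderiv_eq, h3, H.fderiv_fderiv_apply hy, formPotential, inner_sub_left,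
    inner_smul_left, conj_trivial] at h2
  rw [secondFFBilin_apply, ← inner_normalPart_comm, normalPart_of_mem meanCurvature_mem,
    hessian_apply]
  linarith

/-- The Moebius form is closed as soon as the Hessian of `ρ⁻¹` commutes with the shape
operators. -/
theorem normalExtDeriv_moebiusForm_eq_zero (hn : 2 ≤ n) (hu : ∀ y ∈ U, ¬ IsUmbilicalAt h y)
    (hflat : ∀ ξ : EuclideanSpace ℝ (Fin n) → EuclideanSpace ℝ (Fin m), ContDiffOn ℝ ∞ ξ U →
      (∀ y ∈ U, ξ y ∈ normalSpace h y) → ∀ y ∈ U, ∀ u v, normalCurvature h y u v ξ = 0)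
    (hy : y ∈ U)
    (hS : ∀ T : EuclideanSpace ℝ (Fin n) →ₗ[ℝ] EuclideanSpace ℝ (Fin n),
      (∀ u v, ⟪fderiv ℝ h y (T u), fderiv ℝ h y v⟫_ℝ = ⟪fderiv ℝ h y u, fderiv ℝ h y (T v)⟫_ℝ) →
      (∀ u v, secondFFBilin h y (T u) v = secondFFBilin h y u (T v)) →
      ∀ u v, hessian h (fun x => (moebiusFactor h x)⁻¹) y (T u) v
        = hessian h (fun x => (moebiusFactor h x)⁻¹) y u (T v))
    (u v : EuclideanSpace ℝ (Fin n)) : normalExtDeriv h (moebiusForm h) y u v = 0 := by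
  have hy' := H.injective y hy
  have hσ : ContDiffOn ℝ ∞ (fun x => (moebiusFactor h x)⁻¹) U :=
    (H.contDiffOn_moebiusFactor hn hu).inv
      fun z hz => (H.moebiusFactor_pos hn hz (hu z hz)).ne'
  have h1 : ∀ u v, normalDeriv h y u (fun z => moebiusForm h z v)
      = -normalDeriv h y u (fun z => normalDeriv h z v
        (formPotential h fun x => (moebiusFactor h x)⁻¹)) := by
    intro u v
    have : (fun z => moebiusForm h z v) =ᶠ[nhds y]
        fun z => -normalDeriv h z v (formPotential h fun x => (moebiusFactor h x)⁻¹) :=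
      Filter.eventuallyEq_of_mem (H.isOpen.mem_nhds hy) fun z hz => H.moebiusForm_eq hn hu hz v
    rw [normalDeriv, this.fderiv_eq, fderiv_fun_neg, neg_apply, map_neg, ← normalDeriv]
  have h2 := H.normalDeriv_commutator (H.contDiffOn_formPotential hσ) hy u v
  rw [H.secondFF_eq_bilin hy, H.secondFF_eq_bilin hy] at h2
  have key : secondFFBilin h y v (tangentCoord h y
        (fderiv ℝ (formPotential h fun x => (moebiusFactor h x)⁻¹) y u))
      = secondFFBilin h y u (tangentCoord h y
        (fderiv ℝ (formPotential h fun x => (moebiusFactor h x)⁻¹) y v)) := by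
    -- Testing against ξ turns the equality into the commutation of S = σA_H + Hess σ with the shape
    -- operator `T` of ξ.
    refine ext_inner_right ℝ fun ξ => ?_
    obtain ⟨T, hT, hTα⟩ := H.exists_shapeOperator_comm hflat hy ξ
    have hTs : ∀ u v, ⟪fderiv ℝ h y (T u), fderiv ℝ h y v⟫_ℝ
        = ⟪fderiv ℝ h y u, fderiv ℝ h y (T v)⟫_ℝ := fun u v => by
      rw [hT, H.secondFFBilin_comm hy, ← hT, real_inner_comm]
    have e : ∀ u v, ⟪secondFFBilin h y v (tangentCoord h y
        (fderiv ℝ (formPotential h fun x => (moebiusFactor h x)⁻¹) y u)), ξ⟫_ℝ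
        = -((moebiusFactor h y)⁻¹ * ⟪meanCurvature h y, secondFFBilin h y u (T v)⟫_ℝ
          + hessian h (fun x => (moebiusFactor h x)⁻¹) y u (T v)) := fun u v => by
      rw [← hT, real_inner_comm, inner_fderiv_tangentCoord hy', H.inner_fderiv_hessian hσ hy]
    -- The Hessian term commutes with `T` by `hS`, the mean curvature term by the Ricci identity
    -- `hTα`.
    rw [e, e, ← hS T hTs hTα, ← hTα, H.hessian_comm hσ hy, H.secondFFBilin_comm hy]
  rw [normalExtDeriv, h1, h1, neg_sub_neg, ← neg_sub, h2, key, sub_self, neg_zero]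

end IsImmersionOn

end CoordImmersion

/-! ### Gauss equation for a metric conformal to the induced one -/

namespace CoordImmersion

open CoordMetric Module

variable {n m : ℕ} {h : EuclideanSpace ℝ (Fin n) → EuclideanSpace ℝ (Fin m)}
  {U : Set (EuclideanSpace ℝ (Fin n))} {y : EuclideanSpace ℝ (Fin n)}

/-- The vector along the immersion whose tangential part represents `∇_a b`, for the Levi-Civita
connection of the conformal metric `σ⁻² ⟨·, ·⟩_f`. -/
noncomputable def conformalChristoffel
    (h : EuclideanSpace ℝ (Fin n) → EuclideanSpace ℝ (Fin m))
    (σ : EuclideanSpace ℝ (Fin n) → ℝ) (a b z : EuclideanSpace ℝ (Fin n)) :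
    EuclideanSpace ℝ (Fin m) :=
  fderiv ℝ (fderiv ℝ h) z a b - (σ z)⁻¹ • (fderiv ℝ σ z a • fderiv ℝ h z b
    + fderiv ℝ σ z b • fderiv ℝ h z a
    - ⟪fderiv ℝ h z a, fderiv ℝ h z b⟫_ℝ • fderiv ℝ h z (grad (inducedMetric h) σ z))

theorem normalPart_conformalChristoffel (σ : EuclideanSpace ℝ (Fin n) → ℝ)
    (a b : EuclideanSpace ℝ (Fin n)) :
    normalPart h y (conformalChristoffel h σ a b y) = secondFFBilin h y a b := by
  simp only [conformalChristoffel, map_sub, map_smul, map_add, normalPart_fderiv,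
    secondFFBilin_apply]
  simp

theorem inner_conformalChristoffel_fderiv (hy : Function.Injective (fderiv ℝ h y))
    (σ : EuclideanSpace ℝ (Fin n) → ℝ) (a b w : EuclideanSpace ℝ (Fin n)) :
    ⟪conformalChristoffel h σ a b y, fderiv ℝ h y w⟫_ℝ
      = ⟪fderiv ℝ (fderiv ℝ h) y a b, fderiv ℝ h y w⟫_ℝ
        - (σ y)⁻¹ * (fderiv ℝ σ y a * ⟪fderiv ℝ h y b, fderiv ℝ h y w⟫_ℝ
          + fderiv ℝ σ y b * ⟪fderiv ℝ h y a, fderiv ℝ h y w⟫_ℝ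
          - ⟪fderiv ℝ h y a, fderiv ℝ h y b⟫_ℝ * fderiv ℝ σ y w) := by
  simp only [conformalChristoffel, inner_sub_left, inner_add_left, inner_smul_left, conj_trivial,
    inner_fderiv_grad hy]

namespace IsImmersionOn

variable (H : IsImmersionOn h U)
include H

theorem contDiffOn_conformalChristoffel {σ : EuclideanSpace ℝ (Fin n) → ℝ}
    (hσ : ContDiffOn ℝ ∞ σ U) (hσ0 : ∀ z ∈ U, σ z ≠ 0) (a b : EuclideanSpace ℝ (Fin n)) :
    ContDiffOn ℝ ∞ (conformalChristoffel h σ a b) U := by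
  have h1 := fun v : EuclideanSpace ℝ (Fin n) =>
    H.contDiffOn_fderiv_apply (contDiffOn_const (c := v))
  exact ((H.contDiffOn_fderiv_fderiv.clm_apply contDiffOn_const).clm_apply contDiffOn_const).sub
    ((hσ.inv hσ0).fun_smul ((((H.contDiffOn_fderiv_const hσ a).fun_smul (h1 b)).add
      ((H.contDiffOn_fderiv_const hσ b).fun_smul (h1 a))).sub
        (((h1 a).inner ℝ (h1 b)).fun_smul (H.contDiffOn_fderiv_apply (H.contDiffOn_grad hσ)))))

theorem fderiv_inner_fderiv_fderiv (hy : y ∈ U) (a c d : EuclideanSpace ℝ (Fin n)) :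
    fderiv ℝ (fun z => ⟪fderiv ℝ h z c, fderiv ℝ h z d⟫_ℝ) y a
      = ⟪fderiv ℝ (fderiv ℝ h) y a c, fderiv ℝ h y d⟫_ℝ
        + ⟪fderiv ℝ h y c, fderiv ℝ (fderiv ℝ h) y a d⟫_ℝ := by
  rw [fderiv_inner_apply ℝ (H.differentiableAt (H.contDiffOn_fderiv_apply contDiffOn_const) hy)
    (H.differentiableAt (H.contDiffOn_fderiv_apply contDiffOn_const) hy),
    H.fderiv_fderiv_apply hy, H.fderiv_fderiv_apply hy, add_comm]

section Conformal

variable {σ : EuclideanSpace ℝ (Fin n) → ℝ} (hσ : ContDiffOn ℝ ∞ σ U) (hσ0 : ∀ z ∈ U, σ z ≠ 0)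
  {G : EuclideanSpace ℝ (Fin n) → EuclideanSpace ℝ (Fin n) → EuclideanSpace ℝ (Fin n) → ℝ}
  (hG : ∀ z ∈ U, ∀ u v, G z u v = (σ z ^ 2)⁻¹ * ⟪fderiv ℝ h z u, fderiv ℝ h z v⟫_ℝ)
include hσ hσ0 hG

theorem fderiv_conformal (hy : y ∈ U) (a c d : EuclideanSpace ℝ (Fin n)) :
    fderiv ℝ (fun z => G z c d) y a
      = (σ y ^ 2)⁻¹ * (⟪fderiv ℝ (fderiv ℝ h) y a c, fderiv ℝ h y d⟫_ℝ
          + ⟪fderiv ℝ h y c, fderiv ℝ (fderiv ℝ h) y a d⟫_ℝ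
        - 2 * (σ y)⁻¹ * fderiv ℝ σ y a * ⟪fderiv ℝ h y c, fderiv ℝ h y d⟫_ℝ) := by
  have h1 : (fun z => G z c d) =ᶠ[nhds y]
      fun z => (σ z ^ 2)⁻¹ * ⟪fderiv ℝ h z c, fderiv ℝ h z d⟫_ℝ :=
    Filter.eventuallyEq_of_mem (H.isOpen.mem_nhds hy) fun z hz => hG z hz c d
  have h2 : HasFDerivAt (fun z => (σ z ^ 2)⁻¹) _ y :=
    (hasDerivAt_inv (pow_ne_zero 2 (hσ0 y hy))).comp_hasFDerivAt y
      ((H.differentiableAt hσ hy).hasFDerivAt.pow 2)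
  have h3 := H.contDiffOn_inducedMetric c d
  unfold inducedMetric at h3
  rw [h1.fderiv_eq, fderiv_fun_mul h2.differentiableAt (H.differentiableAt h3 hy), h2.fderiv]
  simp only [add_apply, smul_apply, smul_eq_mul, H.fderiv_inner_fderiv_fderiv hy]
  have := hσ0 y hy
  field_simp
  ring

/-- In the Koszul formula the symmetry of D²h leaves only 2⟨D²h(a,b), df w⟩, and the derivatives of
σ⁻² produce the conformal correction. -/
theorem christoffel_conformal (hy : y ∈ U) (a b : EuclideanSpace ℝ (Fin n)) :
    christoffel G y a b = tangentCoord h y (conformalChristoffel h σ a b y) := by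
  have hy' := H.injective y hy
  have h0 := hσ0 y hy
  have h1 : (fun w => (1 / 2 : ℝ) * (fderiv ℝ (fun z => G z b w) y a
      + fderiv ℝ (fun z => G z a w) y b - fderiv ℝ (fun z => G z a b) y w))
      = ((σ y ^ 2)⁻¹ • (innerₗ _ (conformalChristoffel h σ a b y)).comp
        (fderiv ℝ h y).toLinearMap : EuclideanSpace ℝ (Fin n) →ₗ[ℝ] ℝ) := by
    funext w
    simp only [H.fderiv_conformal hσ hσ0 hG hy]
    change _ = (σ y ^ 2)⁻¹ * ⟪_, fderiv ℝ h y w⟫_ℝ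
    rw [inner_conformalChristoffel_fderiv hy', H.fderiv_fderiv_comm hy b a,
      H.fderiv_fderiv_comm hy w a, H.fderiv_fderiv_comm hy w b,
      real_inner_comm (fderiv ℝ (fderiv ℝ h) y a w) (fderiv ℝ h y b)]
    ring
  refine eq_of_inner_fderiv_eq hy' fun w => ?_
  have h2 := inner_sharp (A := (fderiv ℝ h y).toLinearMap) (inv_ne_zero (pow_ne_zero 2 h0))
    (hG y hy) hy' ((σ y ^ 2)⁻¹ • (innerₗ _ (conformalChristoffel h σ a b y)).comp
        (fderiv ℝ h y).toLinearMap) w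
  rw [christoffel, h1, inner_fderiv_tangentCoord hy']
  exact mul_left_cancel₀ (inv_ne_zero (pow_ne_zero 2 h0)) h2

/-- The Gauss equation for a metric conformal to the induced metric. -/
theorem curvature_conformal (hy : y ∈ U) (u v : EuclideanSpace ℝ (Fin n)) :
    ⟪fderiv ℝ h y (curvature G y u v v), fderiv ℝ h y u⟫_ℝ
      = ⟪secondFFBilin h y u u, secondFFBilin h y v v⟫_ℝ
        - ⟪secondFFBilin h y u v, secondFFBilin h y u v⟫_ℝ
        + (σ y)⁻¹ * (hessian h σ y u u * ⟪fderiv ℝ h y v, fderiv ℝ h y v⟫_ℝ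
          + hessian h σ y v v * ⟪fderiv ℝ h y u, fderiv ℝ h y u⟫_ℝ
          - 2 * hessian h σ y u v * ⟪fderiv ℝ h y u, fderiv ℝ h y v⟫_ℝ)
        - (σ y)⁻¹ ^ 2 * fderiv ℝ σ y (grad (inducedMetric h) σ y)
          * (⟪fderiv ℝ h y u, fderiv ℝ h y u⟫_ℝ * ⟪fderiv ℝ h y v, fderiv ℝ h y v⟫_ℝ
            - ⟪fderiv ℝ h y u, fderiv ℝ h y v⟫_ℝ ^ 2) := by
  have hy' := H.injective y hy
  have hq := H.contDiffOn_conformalChristoffel hσ hσ0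
  have hd : ∀ {F : Type} [NormedAddCommGroup F] [NormedSpace ℝ F]
      {x : EuclideanSpace ℝ (Fin n) → F}, ContDiffOn ℝ ∞ x U → DifferentiableAt ℝ x y :=
    fun hx => H.differentiableAt hx hy
  have hcov : ∀ a b c, covDeriv G y a (fun z => covDeriv G z b (fun _ => c))
      = fderiv ℝ (fun z => tangentCoord h z (conformalChristoffel h σ b c z)) y a
        + tangentCoord h y (conformalChristoffel h σ a
          (tangentCoord h y (conformalChristoffel h σ b c y)) y) := by
    intro a b c
    have h1 : ∀ z ∈ U, covDeriv G z b (fun _ => c)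
        = tangentCoord h z (conformalChristoffel h σ b c z) := fun z hz => by
      rw [covDeriv, H.christoffel_conformal hσ hσ0 hG hz]
      simp
    have h2 : (fun z => covDeriv G z b (fun _ => c)) =ᶠ[nhds y]
        fun z => tangentCoord h z (conformalChristoffel h σ b c z) :=
      Filter.eventuallyEq_of_mem (H.isOpen.mem_nhds hy) h1
    rw [covDeriv, h2.fderiv_eq, H.christoffel_conformal hσ hσ0 hG hy, h1 y hy]
  -- Differentiating ⟨df X, df w⟩ = ⟨Q, df w⟩, with X the tangential part of Q, avoids ever
  -- differentiating the inverse Gram matrix.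
  have hfst : ∀ a b c w, ⟪fderiv ℝ h y (fderiv ℝ (fun z => tangentCoord h z
      (conformalChristoffel h σ b c z)) y a), fderiv ℝ h y w⟫_ℝ
      = fderiv ℝ (fun z => ⟪conformalChristoffel h σ b c z, fderiv ℝ h z w⟫_ℝ) y a
        - ⟪fderiv ℝ (fderiv ℝ h) y a (tangentCoord h y (conformalChristoffel h σ b c y)),
            fderiv ℝ h y w⟫_ℝ
        - ⟪fderiv ℝ h y (tangentCoord h y (conformalChristoffel h σ b c y)),
            fderiv ℝ (fderiv ℝ h) y a w⟫_ℝ := by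
    intro a b c w
    have hX := H.contDiffOn_tangentCoord (hq b c)
    have h1 : (fun z => ⟪conformalChristoffel h σ b c z, fderiv ℝ h z w⟫_ℝ) =ᶠ[nhds y]
        fun z => ⟪fderiv ℝ h z (tangentCoord h z (conformalChristoffel h σ b c z)),
          fderiv ℝ h z w⟫_ℝ :=
      Filter.eventuallyEq_of_mem (H.isOpen.mem_nhds hy)
        fun z hz => (inner_fderiv_tangentCoord (H.injective z hz) _ _).symm
    rw [h1.fderiv_eq, fderiv_inner_apply ℝ (hd (H.contDiffOn_fderiv_apply hX))
      (hd (H.contDiffOn_fderiv_apply contDiffOn_const)), H.fderiv_fderiv_apply hy,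
      fderiv_clm_apply (H.differentiableAt_fderiv hy) (hd hX)]
    simp [inner_add_left]
    ring
  -- Tangential part as whole minus normal part: the quadratic α-terms of the Gauss equation come
  -- from here.
  have hX : ∀ b c w, ⟪fderiv ℝ h y (tangentCoord h y (conformalChristoffel h σ b c y)), w⟫_ℝ
      = ⟪conformalChristoffel h σ b c y, w⟫_ℝ
        - ⟪secondFFBilin h y b c, normalPart h y w⟫_ℝ := by
    intro b c w
    rw [← normalPart_conformalChristoffel σ, ← inner_normalPart_comm,
      normalPart_of_mem (normalPart_mem _), ← inner_sub_left, normalPart_eq hy', sub_sub_cancel]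
  have hmul : ∀ {r s : EuclideanSpace ℝ (Fin n) → ℝ}, ContDiffOn ℝ ∞ r U → ContDiffOn ℝ ∞ s U →
      ∀ a, fderiv ℝ (fun z => r z * s z) y a = r y * fderiv ℝ s y a + s y * fderiv ℝ r y a := by
    intro r s hr hs a
    rw [fderiv_fun_mul (hd hr) (hd hs)]
    simp
  have hg := H.contDiffOn_inducedMetric
  unfold inducedMetric at hg
  have hDg : ∀ a b w, ContDiffOn ℝ ∞
      (fun z => ⟪fderiv ℝ (fderiv ℝ h) z a b, fderiv ℝ h z w⟫_ℝ) U := fun a b w =>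
    (((H.contDiffOn_fderiv_fderiv.clm_apply contDiffOn_const).clm_apply contDiffOn_const).inner ℝ
      (H.contDiffOn_fderiv_apply contDiffOn_const))
  have hσd := H.contDiffOn_fderiv_const hσ
  have hσ2 : ∀ a b, fderiv ℝ (fun z => fderiv ℝ σ z b) y a = fderiv ℝ (fderiv ℝ σ) y a b := by
    intro a b
    rw [fderiv_clm_apply (hd (hσ.fderiv_of_isOpen H.isOpen le_rfl)) (differentiableAt_const b)]
    simp
  have hσi : ∀ a, fderiv ℝ (fun z => (σ z)⁻¹) y a = -(σ y)⁻¹ ^ 2 * fderiv ℝ σ y a := by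
    intro a
    have h2 : HasFDerivAt (fun z => (σ z)⁻¹) _ y :=
      (hasDerivAt_inv (hσ0 y hy)).comp_hasFDerivAt y (hd hσ).hasFDerivAt
    rw [h2.fderiv]
    simp
  have e1 : ∀ b c, fderiv ℝ σ y (tangentCoord h y (conformalChristoffel h σ b c y))
      = ⟪fderiv ℝ h y (grad (inducedMetric h) σ y), fderiv ℝ (fderiv ℝ h) y b c⟫_ℝ
        - (σ y)⁻¹ * (2 * fderiv ℝ σ y b * fderiv ℝ σ y c
          - ⟪fderiv ℝ h y b, fderiv ℝ h y c⟫_ℝ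
            * fderiv ℝ σ y (grad (inducedMetric h) σ y)) := by
    intro b c
    rw [← inner_fderiv_grad hy', real_inner_comm, inner_fderiv_tangentCoord hy',
      inner_conformalChristoffel_fderiv hy', real_inner_comm _ (fderiv ℝ h y c),
      real_inner_comm _ (fderiv ℝ h y b), inner_fderiv_grad hy', inner_fderiv_grad hy',
      real_inner_comm]
    ring
  have e2 : ∀ b c a w, ⟪fderiv ℝ h y (tangentCoord h y (conformalChristoffel h σ b c y)),
        fderiv ℝ (fderiv ℝ h) y a w⟫_ℝ
      = ⟪fderiv ℝ (fderiv ℝ h) y b c, fderiv ℝ (fderiv ℝ h) y a w⟫_ℝ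
        - (σ y)⁻¹ * (fderiv ℝ σ y b * ⟪fderiv ℝ h y c, fderiv ℝ (fderiv ℝ h) y a w⟫_ℝ
          + fderiv ℝ σ y c * ⟪fderiv ℝ h y b, fderiv ℝ (fderiv ℝ h) y a w⟫_ℝ
          - ⟪fderiv ℝ h y b, fderiv ℝ h y c⟫_ℝ
            * ⟪fderiv ℝ h y (grad (inducedMetric h) σ y), fderiv ℝ (fderiv ℝ h) y a w⟫_ℝ)
        - ⟪secondFFBilin h y b c, secondFFBilin h y a w⟫_ℝ := by
    intro b c a w
    rw [hX, secondFFBilin_apply a w]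
    simp only [conformalChristoffel, inner_sub_left, inner_add_left, inner_smul_left,
      conj_trivial]
  have e3 := fun b c w => (inner_fderiv_tangentCoord hy' (conformalChristoffel h σ b c y) w).trans
    (inner_conformalChristoffel_fderiv hy' σ b c w)
  have e4 : ∀ a b c w,
      fderiv ℝ (fun z => ⟪conformalChristoffel h σ b c z, fderiv ℝ h z w⟫_ℝ) y a
      = ⟪fderiv ℝ (fun z => fderiv ℝ (fderiv ℝ h) z b c) y a, fderiv ℝ h y w⟫_ℝ
        + ⟪fderiv ℝ (fderiv ℝ h) y b c, fderiv ℝ (fderiv ℝ h) y a w⟫_ℝ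
        + (σ y)⁻¹ ^ 2 * fderiv ℝ σ y a
          * (fderiv ℝ σ y b * ⟪fderiv ℝ h y c, fderiv ℝ h y w⟫_ℝ
            + fderiv ℝ σ y c * ⟪fderiv ℝ h y b, fderiv ℝ h y w⟫_ℝ
            - ⟪fderiv ℝ h y b, fderiv ℝ h y c⟫_ℝ * fderiv ℝ σ y w)
        - (σ y)⁻¹ * (fderiv ℝ (fderiv ℝ σ) y a b * ⟪fderiv ℝ h y c, fderiv ℝ h y w⟫_ℝ
            + fderiv ℝ (fderiv ℝ σ) y a c * ⟪fderiv ℝ h y b, fderiv ℝ h y w⟫_ℝ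
            - ⟪fderiv ℝ h y b, fderiv ℝ h y c⟫_ℝ * fderiv ℝ (fderiv ℝ σ) y a w
            + fderiv ℝ σ y b * (⟪fderiv ℝ (fderiv ℝ h) y a c, fderiv ℝ h y w⟫_ℝ
              + ⟪fderiv ℝ h y c, fderiv ℝ (fderiv ℝ h) y a w⟫_ℝ)
            + fderiv ℝ σ y c * (⟪fderiv ℝ (fderiv ℝ h) y a b, fderiv ℝ h y w⟫_ℝ
              + ⟪fderiv ℝ h y b, fderiv ℝ (fderiv ℝ h) y a w⟫_ℝ)
            - (⟪fderiv ℝ (fderiv ℝ h) y a b, fderiv ℝ h y c⟫_ℝ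
              + ⟪fderiv ℝ h y b, fderiv ℝ (fderiv ℝ h) y a c⟫_ℝ) * fderiv ℝ σ y w) := by
    intro a b c w
    have h1 : (fun z => ⟪conformalChristoffel h σ b c z, fderiv ℝ h z w⟫_ℝ) =ᶠ[nhds y]
        fun z => ⟪fderiv ℝ (fderiv ℝ h) z b c, fderiv ℝ h z w⟫_ℝ
          - (σ z)⁻¹ * (fderiv ℝ σ z b * ⟪fderiv ℝ h z c, fderiv ℝ h z w⟫_ℝ
            + fderiv ℝ σ z c * ⟪fderiv ℝ h z b, fderiv ℝ h z w⟫_ℝ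
            - ⟪fderiv ℝ h z b, fderiv ℝ h z c⟫_ℝ * fderiv ℝ σ z w) :=
      Filter.eventuallyEq_of_mem (H.isOpen.mem_nhds hy)
        fun z hz => inner_conformalChristoffel_fderiv (H.injective z hz) σ b c w
    have c0 : ContDiffOn ℝ ∞ (fun z => (σ z)⁻¹) U := hσ.inv hσ0
    have c1 := (hσd b).mul (hg c w)
    have c2 := (hσd c).mul (hg b w)
    have c3 := (hg b c).mul (hσd w)
    have c4 := (c1.add c2).sub c3
    rw [h1.fderiv_eq, fderiv_fun_sub (hd (hDg b c w)) (hd (c0.mul c4)),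
      sub_apply, hmul c0 c4, fderiv_fun_sub (hd (c1.add c2)) (hd c3), sub_apply,
      fderiv_fun_add (hd c1) (hd c2), add_apply, hmul (hσd b) (hg c w), hmul (hσd c) (hg b w),
      hmul (hg b c) (hσd w), hσi, hσ2, hσ2, hσ2, H.fderiv_inner_fderiv_fderiv hy,
      H.fderiv_inner_fderiv_fderiv hy, H.fderiv_inner_fderiv_fderiv hy,
      fderiv_inner_apply ℝ (hd ((H.contDiffOn_fderiv_fderiv.clm_apply contDiffOn_const).clm_apply
        contDiffOn_const)) (hd (H.contDiffOn_fderiv_apply contDiffOn_const)),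
      H.fderiv_fderiv_apply hy]
    ring
  -- Third derivatives of `h` cancel by symmetry.
  have hT : fderiv ℝ (fun z => fderiv ℝ (fderiv ℝ h) z v v) y u
      = fderiv ℝ (fun z => fderiv ℝ (fderiv ℝ h) z u v) y v := by
    have h1 : ∀ w, (fun z => fderiv ℝ (fderiv ℝ h) z w v) =ᶠ[nhds y]
        fun z => fderiv ℝ (fun x => fderiv ℝ h x v) z w := fun w =>
      Filter.eventuallyEq_of_mem (H.isOpen.mem_nhds hy)
        fun z hz => (H.fderiv_fderiv_apply hz w v).symm
    rw [(h1 v).fderiv_eq, (h1 u).fderiv_eq]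
    exact H.fderiv_fderiv_apply_comm (H.contDiffOn_fderiv_apply contDiffOn_const) hy u v
  rw [curvature, hcov, hcov, map_sub, map_add, map_add, inner_sub_left, inner_add_left,
    inner_add_left, hfst, hfst, e4, e4, e2, e2, inner_fderiv_tangentCoord hy',
    inner_fderiv_tangentCoord hy', inner_conformalChristoffel_fderiv hy',
    inner_conformalChristoffel_fderiv hy', e1, e1,
    real_inner_comm (fderiv ℝ h y (tangentCoord h y (conformalChristoffel h σ v v y)))
      (fderiv ℝ h y u),
    real_inner_comm (fderiv ℝ h y (tangentCoord h y (conformalChristoffel h σ u v y)))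
      (fderiv ℝ h y v), e3, e3, e3, hT, hessian_apply, hessian_apply, hessian_apply,
    H.fderiv_fderiv_comm hy v u, H.secondFFBilin_comm hy v u,
    real_inner_comm (fderiv ℝ h y u) (fderiv ℝ h y v),
    real_inner_comm (secondFFBilin h y u u) (secondFFBilin h y v v)]
  simp only [real_inner_comm (fderiv ℝ h y u) (fderiv ℝ (fderiv ℝ h) y _ _),
    real_inner_comm (fderiv ℝ h y v) (fderiv ℝ (fderiv ℝ h) y _ _),
    real_inner_comm (fderiv ℝ (fderiv ℝ h) y u u) (fderiv ℝ (fderiv ℝ h) y v v)]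
  ring

end Conformal

end IsImmersionOn

end CoordImmersion

/-! ### Constant Moebius curvature -/

namespace CoordImmersion

open CoordMetric Module

variable {n m : ℕ} {h : EuclideanSpace ℝ (Fin n) → EuclideanSpace ℝ (Fin m)}
  {U : Set (EuclideanSpace ℝ (Fin n))} {y : EuclideanSpace ℝ (Fin n)}

/-- Strict Cauchy–Schwarz: with a = |df v|² and b = ⟨df u, df v⟩, the vector a·df u − b·df v has
squared length a times the Gram determinant. -/
theorem gram_ne_zero_of_linearIndependent (hy : Function.Injective (fderiv ℝ h y))
    {u v : EuclideanSpace ℝ (Fin n)} (huv : LinearIndependent ℝ ![u, v]) :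
    ⟪fderiv ℝ h y u, fderiv ℝ h y u⟫_ℝ * ⟪fderiv ℝ h y v, fderiv ℝ h y v⟫_ℝ
      - ⟪fderiv ℝ h y u, fderiv ℝ h y v⟫_ℝ ^ 2 ≠ 0 := by
  intro h0
  set a := ⟪fderiv ℝ h y v, fderiv ℝ h y v⟫_ℝ with ha
  set b := ⟪fderiv ℝ h y u, fderiv ℝ h y v⟫_ℝ with hb
  have h1 : ⟪a • fderiv ℝ h y u - b • fderiv ℝ h y v,
      a • fderiv ℝ h y u - b • fderiv ℝ h y v⟫_ℝ = 0 := by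
    simp only [inner_sub_left, inner_sub_right, inner_smul_left, inner_smul_right, conj_trivial,
      ← ha, ← hb, real_inner_comm (fderiv ℝ h y u) (fderiv ℝ h y v)]
    linear_combination a * h0
  rw [inner_self_eq_zero, ← map_smul, ← map_smul, ← map_sub] at h1
  have h2 := hy (h1.trans (map_zero _).symm)
  have h3 := (LinearIndependent.pair_iff.1 huv a (-b) (by rw [neg_smul, ← sub_eq_add_neg, h2])).1
  rw [ha, inner_self_eq_zero] at h3
  have h4 := huv.ne_zero 1
  exact h4 (hy (h3.trans (map_zero _).symm))

/-- For an immersion with constant Moebius curvature, the Hessian of `ρ⁻¹` commutes with all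
self-adjoint operators with which the second fundamental form commutes. -/
theorem IsImmersionOn.hessian_comm_of_sectionalCurvature (H : IsImmersionOn h U) (hn : 3 ≤ n)
    (hu : ∀ y ∈ U, ¬ IsUmbilicalAt h y) {c : ℝ} (hy : y ∈ U)
    (hc : ∀ u v, LinearIndependent ℝ ![u, v] → sectionalCurvature (moebiusMetric h) y u v = c)
    (T : EuclideanSpace ℝ (Fin n) →ₗ[ℝ] EuclideanSpace ℝ (Fin n))
    (hT : ∀ u v, ⟪fderiv ℝ h y (T u), fderiv ℝ h y v⟫_ℝ
      = ⟪fderiv ℝ h y u, fderiv ℝ h y (T v)⟫_ℝ)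
    (hTα : ∀ u v, secondFFBilin h y (T u) v = secondFFBilin h y u (T v))
    (u v : EuclideanSpace ℝ (Fin n)) :
    hessian h (fun x => (moebiusFactor h x)⁻¹) y (T u) v
      = hessian h (fun x => (moebiusFactor h x)⁻¹) y u (T v) := by
  have hρ := fun z hz => H.moebiusFactor_pos (by omega) hz (hu z hz)
  have hσ : ContDiffOn ℝ ∞ (fun x => (moebiusFactor h x)⁻¹) U :=
    (H.contDiffOn_moebiusFactor (by omega) hu).inv fun z hz => (hρ z hz).ne'
  obtain ⟨b, hb⟩ := exists_isFrame (fderiv ℝ h y).toLinearMap (H.injective y hy)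
  -- Here t = σ⁻¹, and κ = cρ² + σ⁻²|grad σ|² absorbs the gradient term of the conformal Gauss
  -- equation.
  refine apply_comm_of_curvature hb (by simpa using hn) (secondFFBilin h y)
    (H.secondFFBilin_comm hy) _ (H.hessian_comm hσ hy) (inv_ne_zero (inv_ne_zero (hρ y hy).ne'))
    (κ := c * moebiusFactor h y ^ 2 + ((moebiusFactor h y)⁻¹)⁻¹ ^ 2
      * fderiv ℝ (fun x => (moebiusFactor h x)⁻¹) y
        (grad (inducedMetric h) (fun x => (moebiusFactor h x)⁻¹) y))
    (fun u v huv => ?_) T hT hTα u v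
  have h1 := H.curvature_conformal hσ (fun z hz => inv_ne_zero (hρ z hz).ne')
    (G := moebiusMetric h) (fun z _ u v => by
      rw [moebiusMetric, inducedMetric, inv_pow, inv_inv]) hy u v
  have h2 := gram_ne_zero_of_linearIndependent (H.injective y hy) huv
  have h3 := hc u v huv
  have h4 : moebiusFactor h y ^ 2 ≠ 0 := pow_ne_zero 2 (hρ y hy).ne'
  simp only [sectionalCurvature, moebiusMetric, inducedMetric] at h3
  have h5 : ∀ r a b d : ℝ, r * a * (r * b) - (r * d) ^ 2 = r ^ 2 * (a * b - d ^ 2) :=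
    fun _ _ _ _ => by ring
  rw [h5, div_eq_iff (mul_ne_zero (pow_ne_zero 2 h4) h2)] at h3
  -- The numerator of the sectional curvature carries ρ² and its denominator ρ⁴, leaving cρ².
  have h6 := mul_left_cancel₀ h4 (h3.trans (mul_left_comm _ _ _ |>.trans (by rw [sq, mul_assoc])))
  simp only [ContinuousLinearMap.coe_coe]
  rw [h1] at h6
  linear_combination h6

end CoordImmersion

/-! ### From the manifold to charts -/

theorem IsIsometricImmersion.isImmersionOn {n m : ℕ} {M : Type*} [TopologicalSpace M]
    [ChartedSpace (EuclideanSpace ℝ (Fin n)) M] [IsManifold (𝓡 n) ∞ M]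
    {g : Bundle.ContMDiffRiemannianMetric (𝓡 n) ∞ (EuclideanSpace ℝ (Fin n))
      (fun x : M => TangentSpace (𝓡 n) x)}
    {f : M → EuclideanSpace ℝ (Fin m)} (hf : IsIsometricImmersion g f)
    {φ : OpenPartialHomeomorph M (EuclideanSpace ℝ (Fin n))}
    (hφ : φ ∈ IsManifold.maximalAtlas (𝓡 n) ∞ M) :
    CoordImmersion.IsImmersionOn (f ∘ φ.symm) φ.target := by
  have hs := contMDiffOn_symm_of_mem_maximalAtlas hφ
  have hφ' := contMDiffOn_of_mem_maximalAtlas hφ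
  refine ⟨φ.open_target, (hf.contMDiff.comp_contMDiffOn hs).contDiffOn, fun y hy => ?_⟩
  have d1 : MDifferentiableAt (𝓡 n) (𝓡 n) φ.symm y :=
    (hs.contMDiffAt (φ.open_target.mem_nhds hy)).mdifferentiableAt (by simp)
  have d2 : MDifferentiableAt (𝓡 n) (𝓡 n) φ (φ.symm y) :=
    (hφ'.contMDiffAt (φ.open_source.mem_nhds (φ.map_target hy))).mdifferentiableAt (by simp)
  have d3 : MDifferentiableAt (𝓡 n) 𝓘(ℝ, EuclideanSpace ℝ (Fin m)) f (φ.symm y) :=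
    hf.contMDiff.contMDiffAt.mdifferentiableAt (by simp)
  have h1 : (fderiv ℝ (f ∘ φ.symm) y : EuclideanSpace ℝ (Fin n) → EuclideanSpace ℝ (Fin m))
      = (differential n f (φ.symm y)) ∘ (mfderiv (𝓡 n) (𝓡 n) φ.symm y) := by
    rw [← mfderiv_eq_fderiv, mfderiv_comp y d3 d1]
    rfl
  -- A kernel vector of df would have zero `g`-length.
  have h2 : Function.Injective (differential n f (φ.symm y)) := by
    rw [injective_iff_map_eq_zero]
    intro v hv
    by_contra hne
    have := g.pos (φ.symm y) v hne
    rw [← hf.inner_eq, hv, inner_zero_left] at this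
    exact lt_irrefl _ this
  have h3 : Function.LeftInverse (mfderiv (𝓡 n) (𝓡 n) φ (φ.symm y))
      (mfderiv (𝓡 n) (𝓡 n) φ.symm y) := by
    have e1 := mfderiv_comp y d2 d1
    have e2 : φ ∘ φ.symm =ᶠ[nhds y] id :=
      Filter.eventuallyEq_of_mem (φ.open_target.mem_nhds hy) fun z hz => φ.right_inv hz
    rw [e2.mfderiv_eq, mfderiv_id] at e1
    exact fun v => (congrArg (fun L : TangentSpace (𝓡 n) y →L[ℝ] _ => L v) e1).symm
  rw [h1]
  exact h2.comp h3.injective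

theorem mainTheorem7 {n p : ℕ} (hn : 3 ≤ n) {M : Type*} [TopologicalSpace M]
    [ChartedSpace (EuclideanSpace ℝ (Fin n)) M] [IsManifold (𝓡 n) ∞ M]
    (g : Bundle.ContMDiffRiemannianMetric (𝓡 n) ∞ (EuclideanSpace ℝ (Fin n))
      (fun x : M => TangentSpace (𝓡 n) x))
    (f : M → EuclideanSpace ℝ (Fin (n + p)))
    (hf : IsIsometricImmersion g f) (humb : IsUmbilicFree n f)
    (hcurv : ∃ c : ℝ, HasConstantMoebiusCurvature n f c)
    (hflat : HasFlatNormalBundle n f) :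
    HasClosedMoebiusForm n f := by
  intro φ hφ y hy u v
  obtain ⟨c, hc⟩ := hcurv
  have H := hf.isImmersionOn hφ
  exact H.normalExtDeriv_moebiusForm_eq_zero (by omega) (humb φ hφ) (hflat φ hφ) hy
    (H.hessian_comm_of_sectionalCurvature hn (humb φ hφ) hy (hc φ hφ y hy)) u v
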